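/- **Conventions.** Let $(M,\alpha)$ be a $(2n+1)$-dimensional co-oriented contact manifold: $\alpha$ is a smooth 1-form with $\alpha\wedge(d\alpha)^n\neq 0$ everywhere. Its Reeb vector field $Z$ is determined by $i_Z\alpha=1$, $i_Zd\alpha=0$. For a smooth function $f$ on $M$, the contact Hamiltonian vector field is $Y_f=fZ+\hat Y_f$, where $\hat Y_f$ is the unique section of $\ker\alpha$ with $-i_{\hat Y_f}d\alpha=df-Z(f)\,\alpha$. The Jacobi bracket is $[f,g]=Y_f(g)-g\,Z(f)$; in particular $[1,g]=Z(g)$. A submanifold $N$ with inclusion $j:N\to M$ is a contact submanifold of $(M,\alpha)$ if it is transverse to $\ker\alpha$ and $d(j^*\alpha)$ is nondegenerate on $\ker(j^*\alpha)$, so that $j^*\alpha$ is a contact form on $N$. **Theorem.** Let $G_1,\dots,G_{2k}$ be smooth functions on $M$, let $N=\{x\in M: G_1(x)=\dots=G_{2k}(x)=0\}$, with inclusion $j:N\to M$, and suppose that at every point of $N$ $$[1,G_j]=0\quad (j=1,\dots,2k),\qquad \det\big([G_j,G_i]\big)_{i,j}\neq 0 .$$ (a) $N$ is an embedded submanifold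 of $M$, of dimension $2(n-k)+1$ (with $k\le n$ if $N\neq\emptyset$), and $(N,j^*\alpha)$ is a contact submanifold of $(M,\alpha)$ whose Reeb vector field is the restriction of $Z$ to $N$. (b) Let $f$ be a smooth function on $M$. There are unique functions $\lambda_1,\dots,\lambda_{2k}$ on $N$ such that $W_f=Y_f-\sum_{i}\lambda_iY_{G_i}$ satisfies $$dG_j(W_f)=Y_f(G_j)-\sum_i\lambda_i\,Y_{G_i}(G_j)=0\quad\text{on } N,\qquad j=1,\dots,2k,$$ and for these functions $W_f$ is the contact Hamiltonian vector field of $f|_N$ on $(N,j^*\alpha)$. For every smooth function $g$ on $M$, the Jacobi bracket $[\cdot,\cdot]_N$ of $(N,j^*\alpha)$ satisfies, on $N$, $$[f|_N,g|_N]_N=[f,g]+\sum_{i,j}[G_i,g]\,A_{ij}\,[G_j,f],$$ where $(A_{ij})$ is the inverse of the matrix whose entry in row $i$ and column $j$ is $[G_j,G_i]$. In particular, if $Y_f$ is tangent to $N$ at all points of $N$, or $Y_g$ is, then $[f|_N,g|_N]_N=[f,g]$ on $N$. -/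

import Mathlib

open scoped Manifold ContDiff

namespace ContactDirac

noncomputable section

/-- A (not necessarily smooth) 1-form on a `d`-dimensional manifold without boundary:
a covector at every point. -/
abbrev OneForm (d : ℕ) (M : Type*) [TopologicalSpace M]
    [ChartedSpace (EuclideanSpace ℝ (Fin d)) M] : Type _ :=
  ∀ x : M, TangentSpace (𝓡 d) x →L[ℝ] ℝ

section Forms

variable {d : ℕ} {M : Type*} [TopologicalSpace M] [ChartedSpace (EuclideanSpace ℝ (Fin d)) M]

/-- Smoothness of a 1-form, as a section of the cotangent bundle. -/
def OneForm.IsSmooth [IsManifold (𝓡 d) ∞ M] (α : OneForm d M) : Prop :=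
  ContMDiff (𝓡 d) ((𝓡 d).prod 𝓘(ℝ, EuclideanSpace ℝ (Fin d) →L[ℝ] ℝ)) ∞
    (fun x : M => Bundle.TotalSpace.mk' (EuclideanSpace ℝ (Fin d) →L[ℝ] ℝ)
      (E := fun y : M => TangentSpace (𝓡 d) y →L[ℝ] Bundle.Trivial M ℝ y) x (α x))

/-- The expression of a 1-form in the preferred chart at `x₀`: its pullback by the inverse of that
chart, a 1-form on an open subset of Euclidean space (namely the target of the chart). -/
def OneForm.inChart (α : OneForm d M) (x₀ : M) (y : EuclideanSpace ℝ (Fin d)) :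
    EuclideanSpace ℝ (Fin d) [⋀^Fin 1]→L[ℝ] ℝ :=
  ContinuousAlternatingMap.ofSubsingleton ℝ (EuclideanSpace ℝ (Fin d)) ℝ (0 : Fin 1)
    ((α ((extChartAt (𝓡 d) x₀).symm y)).comp
      (mfderiv 𝓘(ℝ, EuclideanSpace ℝ (Fin d)) (𝓡 d) (extChartAt (𝓡 d) x₀).symm y))

/-- The exterior derivative `dα` of a 1-form, computed at `x` in the preferred chart at `x`
and transported back to the tangent space at `x` by the differential of the chart. The
normalization is `dα(X, Y) = X(α(Y)) - Y(α(X)) - α([X, Y])`. -/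
def OneForm.extDeriv (α : OneForm d M) (x : M) : TangentSpace (𝓡 d) x [⋀^Fin 2]→L[ℝ] ℝ :=
  (_root_.extDeriv (α.inChart x) (extChartAt (𝓡 d) x x)).compContinuousLinearMap
    (mfderiv (𝓡 d) 𝓘(ℝ, EuclideanSpace ℝ (Fin d)) (extChartAt (𝓡 d) x) x)

/-- The pullback `j^* α` of a 1-form by a map `j`. -/
def OneForm.pullback {e : ℕ} {N : Type*} [TopologicalSpace N]
    [ChartedSpace (EuclideanSpace ℝ (Fin e)) N] (j : N → M) (α : OneForm d M) : OneForm e N :=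
  fun x => (α (j x)).comp (mfderiv (𝓡 e) (𝓡 d) j x)

/-- The differential `df` of a function, as a 1-form. -/
def differential (f : M → ℝ) : OneForm d M := mvfderiv (𝓡 d) f

/-- Smooth real-valued functions. -/
def IsSmoothFun (d : ℕ) {M : Type*} [TopologicalSpace M]
    [ChartedSpace (EuclideanSpace ℝ (Fin d)) M] (f : M → ℝ) : Prop :=
  ContMDiff (𝓡 d) 𝓘(ℝ, ℝ) ∞ f

/-- `z` is the value at `x` of the Reeb vector field of `α`: `i_z α = 1` and `i_z dα = 0`. -/
def IsReebVector (α : OneForm d M) (x : M) (z : TangentSpace (𝓡 d) x) : Prop :=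
  α x z = 1 ∧ ∀ w : TangentSpace (𝓡 d) x, α.extDeriv x ![z, w] = 0

/-- The Reeb vector field `Z` of `α`; it is meaningful when `α` is a contact form, since then
exactly one vector at each point satisfies the defining conditions. -/
def reeb (α : OneForm d M) (x : M) : TangentSpace (𝓡 d) x :=
  Classical.epsilon (IsReebVector α x)

/-- The inverse of the restriction to the horizontal vectors (those in `ker α`) of
`v ↦ - i_v dα`; it is meaningful when `α` is a contact form and `η` is semi-basic, i.e. `η`
vanishes on the Reeb vector, since then there is exactly one such `v`. -/
def sharp (α : OneForm d M) (x : M) (η : TangentSpace (𝓡 d) x →L[ℝ] ℝ) :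
    TangentSpace (𝓡 d) x :=
  Classical.epsilon fun v => α x v = 0 ∧
    ∀ w : TangentSpace (𝓡 d) x, - α.extDeriv x ![v, w] = η w

/-- The contact Hamiltonian vector field `Y_f = f Z + α^♯(df - Z(f) α)`; here `df - Z(f) α` is
the semi-basic part of `df`. -/
def contactHam (α : OneForm d M) (f : M → ℝ) (x : M) : TangentSpace (𝓡 d) x :=
  f x • reeb α x + sharp α x (differential f x - differential f x (reeb α x) • α x)

/-- The Jacobi bracket `[f, g] = Y_f(g) - g Z(f)`. -/
def jacobiBracket (α : OneForm d M) (f g : M → ℝ) (x : M) : ℝ :=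
  differential g x (contactHam α f x) - g x * differential f x (reeb α x)

end Forms

section Contact

variable {n : ℕ} {M : Type*} [TopologicalSpace M]
  [ChartedSpace (EuclideanSpace ℝ (Fin (2 * n + 1))) M]

/-- The value of the top degree form `α ∧ (dα)^n` at `x` on the vectors `v 0, …, v (2 n)`. -/
def contactVolume (α : OneForm (2 * n + 1) M) (x : M)
    (v : Fin (2 * n + 1) → TangentSpace (𝓡 (2 * n + 1)) x) : ℝ :=
  (1 / 2 ^ n) * ∑ σ : Equiv.Perm (Fin (2 * n + 1)), ((Equiv.Perm.sign σ : ℤ) : ℝ) *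
    (α x (v (σ 0)) * ∏ i : Fin n, α.extDeriv x
      ![v (σ ⟨2 * (i : ℕ) + 1, by omega⟩), v (σ ⟨2 * (i : ℕ) + 2, by omega⟩)])

/-- `α` is a contact form: a smooth 1-form such that `α ∧ (dα)^n` vanishes nowhere. -/
def IsContactForm [IsManifold (𝓡 (2 * n + 1)) ∞ M] (α : OneForm (2 * n + 1) M) : Prop :=
  α.IsSmooth ∧ ∀ x : M, ∃ v, contactVolume α x v ≠ 0

end Contact

/-- `(N, j^* α)` is a co-oriented contact submanifold of `(M, α)`: `j` is a smooth embedding,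
`N` is transverse to `ker α`, `d(j^* α)` is nondegenerate on `ker (j^* α)`, and `j^* α` is a
contact form on `N`. -/
structure IsContactSubmanifold {d m : ℕ} {M N : Type*} [TopologicalSpace M] [TopologicalSpace N]
    [ChartedSpace (EuclideanSpace ℝ (Fin d)) M]
    [ChartedSpace (EuclideanSpace ℝ (Fin (2 * m + 1))) N]
    [IsManifold (𝓡 (2 * m + 1)) ∞ N] (α : OneForm d M) (j : N → M) : Prop where
  isSmoothEmbedding : Manifold.IsSmoothEmbedding (𝓡 (2 * m + 1)) (𝓡 d) ∞ j
  transverse : ∀ x : N, (mfderiv (𝓡 (2 * m + 1)) (𝓡 d) j x).range ⊔ (α (j x)).ker = ⊤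
  nondegenerate : ∀ (x : N) (v : TangentSpace (𝓡 (2 * m + 1)) x),
    (α.pullback j : OneForm (2 * m + 1) N) x v = 0 →
    (∀ w : TangentSpace (𝓡 (2 * m + 1)) x, (α.pullback j : OneForm (2 * m + 1) N) x w = 0 →
      (α.pullback j : OneForm (2 * m + 1) N).extDeriv x ![v, w] = 0) → v = 0
  isContactForm : IsContactForm (α.pullback j : OneForm (2 * m + 1) N)

/-- The common zero set of a family of functions. -/
def zeroLocus {ι M : Type*} (G : ι → M → ℝ) : Set M := {x | ∀ i, G i x = 0}

/-- The inclusion of the common zero set of a family of functions. -/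
abbrev incl {ι M : Type*} (G : ι → M → ℝ) : zeroLocus G → M := Subtype.val

section Constraints

variable {d : ℕ} {M : Type*} [TopologicalSpace M] [ChartedSpace (EuclideanSpace ℝ (Fin d)) M]
  {ι : Type*} [Fintype ι]

/-- The matrix of brackets of the constraints, with `[G_j, G_i](x)` in row `i`, column `j`. -/
def bracketMatrix (α : OneForm d M) (G : ι → M → ℝ) (x : M) : Matrix ι ι ℝ :=
  Matrix.of fun i j => jacobiBracket α (G j) (G i) x

/-- The vector `W_f = Y_f - ∑ i, c_i Y_{G_i}` at `x`. -/
def correctedHam (α : OneForm d M) (G : ι → M → ℝ) (f : M → ℝ) (c : ι → ℝ) (x : M) :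
    TangentSpace (𝓡 d) x :=
  contactHam α f x - ∑ i, c i • contactHam α (G i) x

/-- The functions `c_i` on `N = {G = 0}` solve the multiplier equations `dG_j(W_f) = 0`. -/
def IsMultiplier (α : OneForm d M) (G : ι → M → ℝ) (f : M → ℝ) (c : ι → zeroLocus G → ℝ) : Prop :=
  ∀ (x : zeroLocus G) (j : ι),
    differential (G j) (x : M) (correctedHam α G f (fun i => c i x) x) = 0

end Constraints

end

end ContactDirac

open ContactDirac

/-! The argument is pointwise symplectic linear algebra along `N`, joined to the regular value
theorem and the naturality of `d` under pullback.

Since `Z(G_i) = 0` and `G_i = 0` on `N`, the fields `Y_{G_i}` there satisfy `α(Y_{G_i}) = 0` and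
`dα(Y_{G_i}, ·) = -dG_i`, and the bracket matrix is just `dG_i(Y_{G_j})`. Its invertibility has two
consequences. The differentials `dG_i` are independent, so `N` is a regular level set with tangent
space the common kernel of the `dG_i`. And `TM = TN ⊕ span(Y_{G_j})` along `N`, a splitting that is
`dα`-orthogonal because `dG_i` kills `TN`. A vector tangent to `N` that is degenerate for the pulled
back pair `(j^*α, d j^*α)` is then degenerate for `(α, dα)`, hence zero
(`IsContactPair.eq_zero_of_forall_mem_ker`). The Reeb field is tangent to `N`, so by uniqueness it
is the Reeb field of `N`.

For (b), the multiplier equations form a linear system with the bracket matrix. Subtracting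
multiples of `Y_{G_i}` from `Y_f` changes neither `α(Y_f)` on `N` nor `dα(Y_f, ·)` on `TN`; so
`W_f`, being tangent, satisfies the equations that characterize the Hamiltonian field of `f|_N`. The
bracket formula is `dg(W_f) - g Z(f)` with the multipliers solved for, using antisymmetry of the
Jacobi bracket.

The contact condition is used throughout in the form "`α` and `dα` have no common kernel vector";
`isContactAt_iff` proves this equivalent to the nonvanishing of `α ∧ (dα)^n`.
`OneForm.IsSmooth.extDeriv_pullback` gives `d j^* = j^* d`, and
`exists_isSmoothEmbedding_of_slice_charts` builds the manifold structure of `N`. -/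

namespace ContactDirac

/-! ### Linear algebra of contact pairs: `a ∧ B^n ≠ 0` versus trivial common kernel. -/

section LinearAlgebra

variable {V : Type*} [AddCommGroup V] [Module ℝ V]

/-- The integrand of `α ∧ ω ∧ ⋯ ∧ ω`, before antisymmetrization. -/
def contactProduct (n : ℕ) (a : V →ₗ[ℝ] ℝ) (B : LinearMap.BilinForm ℝ V)
    (v : Fin (2 * n + 1) → V) : ℝ :=
  a (v 0) * ∏ i : Fin n, B (v ⟨2 * (i : ℕ) + 1, by omega⟩) (v ⟨2 * (i : ℕ) + 2, by omega⟩)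

/-- Each vector enters exactly one factor of the product: slot `0` enters `a`, and slots `2i+1`,
`2i+2` enter the `i`-th factor `B`. Multilinearity follows. -/
theorem exists_contactProduct_update {n : ℕ} (a : V →ₗ[ℝ] ℝ) (B : LinearMap.BilinForm ℝ V)
    (v : Fin (2 * n + 1) → V) (j : Fin (2 * n + 1)) :
    ∃ ℓ : V →ₗ[ℝ] ℝ, ∀ x, contactProduct n a B (Function.update v j x) = ℓ x := by
  classical
  rcases Fin.eq_zero_or_eq_succ j with rfl | ⟨k, rfl⟩
  · refine ⟨(∏ i : Fin n, B (v ⟨2 * (i : ℕ) + 1, by omega⟩) (v ⟨2 * (i : ℕ) + 2, by omega⟩)) • a,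
      fun x => ?_⟩
    simp [contactProduct, Fin.ext_iff, mul_comm]
  · obtain ⟨i, hi⟩ : ∃ i : Fin n, (k : ℕ) = 2 * i ∨ (k : ℕ) = 2 * i + 1 :=
      ⟨⟨k / 2, by omega⟩, by dsimp only; omega⟩
    have key : ∀ x, contactProduct n a B (Function.update v k.succ x) =
        (a (v 0) * ∏ l ∈ Finset.univ.erase i,
          B (v ⟨2 * (l : ℕ) + 1, by omega⟩) (v ⟨2 * (l : ℕ) + 2, by omega⟩)) *
        B (Function.update v k.succ x ⟨2 * (i : ℕ) + 1, by omega⟩)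
          (Function.update v k.succ x ⟨2 * (i : ℕ) + 2, by omega⟩) := by
      intro x
      rw [contactProduct, ← Finset.mul_prod_erase _ _ (Finset.mem_univ i),
        Function.update_of_ne (Fin.succ_ne_zero k).symm]
      have : ∀ l ∈ Finset.univ.erase i,
          B (Function.update v k.succ x ⟨2 * (l : ℕ) + 1, by omega⟩)
            (Function.update v k.succ x ⟨2 * (l : ℕ) + 2, by omega⟩) =
          B (v ⟨2 * (l : ℕ) + 1, by omega⟩) (v ⟨2 * (l : ℕ) + 2, by omega⟩) := by
        intro l hl
        have hl' : (l : ℕ) ≠ i := fun h => (Finset.mem_erase.mp hl).1 (Fin.ext h)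
        rw [Function.update_of_ne, Function.update_of_ne] <;>
          simp only [ne_eq, Fin.ext_iff, Fin.val_succ] <;> omega
      rw [Finset.prod_congr rfl this]
      ring
    rcases hi with hi | hi
    · refine ⟨(a (v 0) * ∏ l ∈ Finset.univ.erase i,
        B (v ⟨2 * (l : ℕ) + 1, by omega⟩) (v ⟨2 * (l : ℕ) + 2, by omega⟩)) •
          B.flip (v ⟨2 * (i : ℕ) + 2, by omega⟩), fun x => ?_⟩
      have h1 : (⟨2 * (i : ℕ) + 1, by omega⟩ : Fin (2 * n + 1)) = k.succ :=
        Fin.ext (by simp [hi])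
      rw [key, h1, Function.update_self, Function.update_of_ne]
      · simp
      · simp only [ne_eq, Fin.ext_iff, Fin.val_succ]; omega
    · refine ⟨(a (v 0) * ∏ l ∈ Finset.univ.erase i,
        B (v ⟨2 * (l : ℕ) + 1, by omega⟩) (v ⟨2 * (l : ℕ) + 2, by omega⟩)) •
          B (v ⟨2 * (i : ℕ) + 1, by omega⟩), fun x => ?_⟩
      have h1 : (⟨2 * (i : ℕ) + 2, by omega⟩ : Fin (2 * n + 1)) = k.succ :=
        Fin.ext (by simp [hi])
      rw [key, h1, Function.update_self, Function.update_of_ne]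
      · simp
      · simp only [ne_eq, Fin.ext_iff, Fin.val_succ]; omega

/-- `contactProduct` as a multilinear map. -/
def contactMultilinear (n : ℕ) (a : V →ₗ[ℝ] ℝ) (B : LinearMap.BilinForm ℝ V) :
    MultilinearMap ℝ (fun _ : Fin (2 * n + 1) => V) ℝ :=
  MultilinearMap.mk' (contactProduct n a B)
    (fun v j x y => by
      obtain ⟨ℓ, hℓ⟩ := exists_contactProduct_update a B v j
      simp only [hℓ, map_add])
    (fun v j c x => by
      obtain ⟨ℓ, hℓ⟩ := exists_contactProduct_update a B v j
      simp only [hℓ, map_smul])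

/-- The top degree form `a ∧ B ∧ ⋯ ∧ B`, up to a nonzero factor. -/
noncomputable def contactTopForm (n : ℕ) (a : V →ₗ[ℝ] ℝ) (B : LinearMap.BilinForm ℝ V) :
    V [⋀^Fin (2 * n + 1)]→ₗ[ℝ] ℝ :=
  MultilinearMap.alternatization (contactMultilinear n a B)

theorem contactTopForm_apply {n : ℕ} (a : V →ₗ[ℝ] ℝ) (B : LinearMap.BilinForm ℝ V)
    (v : Fin (2 * n + 1) → V) :
    contactTopForm n a B v = ∑ σ : Equiv.Perm (Fin (2 * n + 1)),
      ((Equiv.Perm.sign σ : ℤ) : ℝ) * contactProduct n a B (fun i => v (σ i)) := by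
  rw [contactTopForm, MultilinearMap.alternatization_apply]
  refine Finset.sum_congr rfl fun σ _ => ?_
  rw [Units.smul_def, zsmul_eq_mul]
  rfl

/-- The pair `(a, B)` has trivial common kernel. -/
def IsContactPair (a : V →ₗ[ℝ] ℝ) (B : LinearMap.BilinForm ℝ V) : Prop :=
  ∀ z, a z = 0 → (∀ w, B z w = 0) → z = 0

theorem contactProduct_eq_zero {n : ℕ} {a : V →ₗ[ℝ] ℝ} {B : LinearMap.BilinForm ℝ V}
    (hB : B.IsAlt) {z : V} (haz : a z = 0) (hBz : ∀ w, B z w = 0)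
    {v : Fin (2 * n + 1) → V} {j : Fin (2 * n + 1)} (hj : v j = z) :
    contactProduct n a B v = 0 := by
  have hBz' : ∀ w, B w z = 0 := fun w => by rw [← hB.neg_eq, hBz, neg_zero]
  rw [contactProduct]
  rcases Fin.eq_zero_or_eq_succ j with rfl | ⟨k, rfl⟩
  · rw [hj, haz, zero_mul]
  · obtain ⟨i, hi⟩ : ∃ i : Fin n, (k : ℕ) = 2 * i ∨ (k : ℕ) = 2 * i + 1 :=
      ⟨⟨k / 2, by omega⟩, by dsimp only; omega⟩
    rw [Finset.prod_eq_zero (Finset.mem_univ i), mul_zero]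
    rcases hi with hi | hi
    · rw [show (⟨2 * (i : ℕ) + 1, by omega⟩ : Fin (2 * n + 1)) = k.succ from
        Fin.ext (by simp [hi]), hj, hBz]
    · rw [show (⟨2 * (i : ℕ) + 2, by omega⟩ : Fin (2 * n + 1)) = k.succ from
        Fin.ext (by simp [hi]), hj, hBz']

/-- A nonzero top form makes `v` a basis. Replacing by a common kernel vector `z` a basis vector on
which `z` has a nonzero coordinate multiplies the form by that coordinate, yet it annihilates every
term of the antisymmetrization. -/
theorem IsContactPair.of_contactTopForm_ne_zero {n : ℕ} {a : V →ₗ[ℝ] ℝ}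
    {B : LinearMap.BilinForm ℝ V} (hB : B.IsAlt) (hV : Module.finrank ℝ V = 2 * n + 1)
    {v : Fin (2 * n + 1) → V} (hv : contactTopForm n a B v ≠ 0) : IsContactPair a B := by
  classical
  intro z haz hBz
  by_contra hz
  have hlin : LinearIndependent ℝ v := by
    by_contra h
    exact hv ((contactTopForm n a B).map_linearDependent v h)
  let b := basisOfLinearIndependentOfCardEqFinrank hlin (by simp [hV])
  have hb : ∀ i, b i = v i := fun i => by simp [b]
  obtain ⟨j, hj⟩ : ∃ j, b.repr z j ≠ 0 := by
    by_contra! h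
    exact hz (b.repr.map_eq_zero_iff.mp (Finsupp.ext h))
  have hzero : contactTopForm n a B (Function.update v j z) = 0 := by
    rw [contactTopForm_apply]
    refine Finset.sum_eq_zero fun σ _ => ?_
    rw [contactProduct_eq_zero hB haz hBz (j := σ.symm j) (by simp), mul_zero]
  have hsum : contactTopForm n a B (Function.update v j z) =
      b.repr z j * contactTopForm n a B v := by
    conv_lhs => rw [← b.sum_repr z]
    rw [AlternatingMap.map_update_sum, Finset.sum_eq_single j]
    · rw [AlternatingMap.map_update_smul, hb, Function.update_eq_self, smul_eq_mul]
    · intro i _ hij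
      rw [AlternatingMap.map_update_smul, hb, AlternatingMap.map_update_self _ _ hij.symm,
        smul_zero]
    · simp
  rw [hzero] at hsum
  exact mul_ne_zero hj hv hsum.symm

variable [FiniteDimensional ℝ V]

/-- The Gram matrix is skew of odd size, so its determinant equals its own negative. -/
theorem exists_forall_eq_zero_of_isAlt_of_odd {B : LinearMap.BilinForm ℝ V}
    (hB : B.IsAlt) (hV : Odd (Module.finrank ℝ V)) : ∃ z ≠ 0, ∀ w, B z w = 0 := by
  let b := Module.finBasis ℝ V
  let A : Matrix _ _ ℝ := Matrix.of fun i j => B (b i) (b j)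
  have hA : A.det = 0 := by
    have h1 : A.transpose = -A := by
      ext i j
      simp only [A, Matrix.transpose_apply, Matrix.of_apply, Matrix.neg_apply]
      rw [hB.neg_eq]
    have h2 := congrArg Matrix.det h1
    rw [Matrix.det_transpose, Matrix.det_neg, Fintype.card_fin, hV.neg_one_pow] at h2
    linarith
  obtain ⟨c, hc, hAc⟩ := Matrix.exists_vecMul_eq_zero_iff.mpr hA
  refine ⟨∑ i, c i • b i, fun h => hc ?_, fun w => ?_⟩
  · exact funext fun i => Fintype.linearIndependent_iff.mp b.linearIndependent c h i
  · have : B (∑ i, c i • b i) = 0 := b.ext fun j => by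
      have := congrFun hAc j
      simpa [Matrix.vecMul, dotProduct, A] using this
    rw [this, LinearMap.zero_apply]

namespace IsContactPair

variable {a : V →ₗ[ℝ] ℝ} {B : LinearMap.BilinForm ℝ V}

theorem exists_reeb (h : IsContactPair a B) (hB : B.IsAlt) (hV : Odd (Module.finrank ℝ V)) :
    ∃ z, a z = 1 ∧ ∀ w, B z w = 0 := by
  obtain ⟨z, hz, hBz⟩ := exists_forall_eq_zero_of_isAlt_of_odd hB hV
  have haz : a z ≠ 0 := fun h0 => hz (h z h0 hBz)
  exact ⟨(a z)⁻¹ • z, by simp [haz], fun w => by simp [hBz]⟩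

omit [FiniteDimensional ℝ V] in
theorem eq_of_forall_eq (h : IsContactPair a B) {v w : V} (ha : a v = a w)
    (hB : ∀ u, B v u = B w u) : v = w :=
  sub_eq_zero.mp (h _ (by simp [ha]) fun u => by simp [hB])

/-- The map `v ↦ a(v) a - B(v, ·)` from `V` to its dual is injective, hence onto; evaluating a
preimage of `η` on the Reeb vector `z` gives `a(v) = η(z) = 0`. -/
theorem exists_sharp (h : IsContactPair a B) (hB : B.IsAlt) {z : V} (haz : a z = 1)
    (hBz : ∀ w, B z w = 0) {η : V →ₗ[ℝ] ℝ} (hη : η z = 0) :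
    ∃ v, a v = 0 ∧ ∀ w, -B v w = η w := by
  have hBz' : ∀ w, B w z = 0 := fun w => by rw [← hB.neg_eq, hBz, neg_zero]
  let L : V →ₗ[ℝ] Module.Dual ℝ V := a.smulRight a - B
  have hL : Function.Injective L := by
    rw [injective_iff_map_eq_zero]
    intro v hv
    have h0 : ∀ w, a v * a w - B v w = 0 := fun w => by
      simpa [L] using LinearMap.congr_fun hv w
    have hav : a v = 0 := by simpa [haz, hBz'] using h0 z
    exact h v hav fun w => by simpa [hav] using h0 w
  obtain ⟨v, hv⟩ := (LinearMap.injective_iff_surjective_of_finrank_eq_finrank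
    (Subspace.dual_finrank_eq (K := ℝ) (V := V)).symm).mp hL η
  have h0 : ∀ w, a v * a w - B v w = η w := fun w => by
    simpa [L] using LinearMap.congr_fun hv w
  have hav : a v = 0 := by simpa [haz, hBz', hη] using h0 z
  exact ⟨v, hav, fun w => by simpa [hav] using h0 w⟩

/-- Symplectic families of every size in the kernel of `a`. -/
theorem exists_symplectic_family (h : IsContactPair a B) (hB : B.IsAlt) {z : V} (haz : a z = 1)
    (hBz : ∀ w, B z w = 0) {n : ℕ} (hV : Module.finrank ℝ V = 2 * n + 1) :
    ∀ j ≤ n, ∃ e f : Fin j → V, (∀ i, a (e i) = 0) ∧ (∀ i, a (f i) = 0) ∧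
      (∀ i l, B (e i) (e l) = 0) ∧ (∀ i l, B (f i) (f l) = 0) ∧
      ∀ i l, B (e i) (f l) = if i = l then 1 else 0 := by
  have hBz' : ∀ w, B w z = 0 := fun w => by rw [← hB.neg_eq, hBz, neg_zero]
  intro j
  induction j with
  | zero => exact fun _ => ⟨Fin.elim0, Fin.elim0, by simp⟩
  | succ j ih =>
    intro hj
    obtain ⟨e, f, hae, haf, hee, hff, hef⟩ := ih (by omega)
    have hfe : ∀ i l, B (f i) (e l) = if i = l then -1 else 0 := fun i l => by
      rw [← hB.neg_eq, hef]
      by_cases hil : i = l <;> simp [hil, eq_comm]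
    -- The next vector `x` must be `B`-orthogonal to the earlier family and lie in `ker a`: that is
    -- `2j + 1 < 2n + 1` linear conditions.
    let L : V →ₗ[ℝ] (Fin j → ℝ) × (Fin j → ℝ) × ℝ :=
      (LinearMap.pi fun i => B (e i)).prod ((LinearMap.pi fun i => B (f i)).prod a)
    have hker : L.ker ≠ ⊥ := L.ker_ne_bot_of_finrank_lt (by simp [hV]; omega)
    obtain ⟨x, hx, hx0⟩ := L.ker.ne_bot_iff.mp hker
    have hLx : (∀ i, B (e i) x = 0) ∧ (∀ i, B (f i) x = 0) ∧ a x = 0 := by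
      simpa [L, Prod.ext_iff, funext_iff] using hx
    obtain ⟨hex, hfx, hax⟩ := hLx
    have hxe : ∀ i, B x (e i) = 0 := fun i => by rw [← hB.neg_eq, hex, neg_zero]
    have hxf : ∀ i, B x (f i) = 0 := fun i => by rw [← hB.neg_eq, hfx, neg_zero]
    obtain ⟨y, hy⟩ : ∃ y, B x y ≠ 0 := by
      by_contra! h0
      exact hx0 (h x hax h0)
    -- The components of `y` along `z`, `e` and `f` are removed, and the result is scaled. All
    -- removed vectors are `B`-orthogonal to `x`, so the pairing with `x` survives.
    let y' : V := (B x y)⁻¹ • (y - a y • z - ∑ i, B (e i) y • f i + ∑ i, B (f i) y • e i)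
    have hxy' : B x y' = 1 := by
      simp [y', hBz', hxe, hxf, hy]
    have hay' : a y' = 0 := by simp [y', haz, hae, haf]
    have hey' : ∀ i, B (e i) y' = 0 := fun i => by
      simp [y', hBz', hee, hef]
    have hfy' : ∀ i, B (f i) y' = 0 := fun i => by
      simp [y', hBz', hff, hfe]
    have hy'f : ∀ i, B y' (f i) = 0 := fun i => by rw [← hB.neg_eq, hfy', neg_zero]
    refine ⟨Fin.cons x e, Fin.cons y' f, ?_, ?_, ?_, ?_, ?_⟩
    · exact Fin.cases (by simpa) (by simpa)
    · exact Fin.cases (by simpa) (by simpa)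
    · refine Fin.cases (Fin.cases ?_ ?_) fun i => Fin.cases ?_ ?_
      · simpa using hB x
      · simpa using hxe
      · simpa using hex i
      · simpa using hee i
    · refine Fin.cases (Fin.cases ?_ ?_) fun i => Fin.cases ?_ ?_
      · simpa using hB y'
      · simpa using hy'f
      · simpa using hfy' i
      · simpa using hff i
    · refine Fin.cases (Fin.cases ?_ ?_) fun i => Fin.cases ?_ ?_
      · simpa using hxy'
      · intro l; simpa [(Fin.succ_ne_zero l).symm] using hxf l
      · simpa using hey' i
      · simpa using hef i

end IsContactPair

/-- The standard symplectic form evaluated on basis vectors indexed by `Fin n × Fin 2`. -/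
def symplecticSign {n : ℕ} (p q : Fin n × Fin 2) : ℤ :=
  if p.1 = q.1 then (if p.2 = 0 ∧ q.2 = 1 then 1 else if p.2 = 1 ∧ q.2 = 0 then -1 else 0) else 0

/-- A permutation that does not kill the standard symplectic pairing permutes the pairs, and its
sign is the product of the pairings. -/
theorem sign_eq_prod_symplecticSign {n : ℕ} (ρ : Equiv.Perm (Fin n × Fin 2))
    (h : ∀ i, symplecticSign (ρ (i, 0)) (ρ (i, 1)) ≠ 0) :
    (Equiv.Perm.sign ρ : ℤ) = ∏ i, symplecticSign (ρ (i, 0)) (ρ (i, 1)) := by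
  have h1 : ∀ i, (ρ (i, 0)).1 = (ρ (i, 1)).1 := fun i => by
    by_contra hne
    exact h i (by simp [symplecticSign, hne])
  have h2 : ∀ i, (ρ (i, 0)).2 = 0 ∧ (ρ (i, 1)).2 = 1 ∨ (ρ (i, 0)).2 = 1 ∧ (ρ (i, 1)).2 = 0 :=
    fun i => by
      have := h i
      simp only [symplecticSign, h1 i, if_true] at this
      by_contra! hne
      grind
  -- The images of `(i, 0)` and `(i, 1)` already fill one pair, so no other `(j, 0)` can land in it.
  have hinj : Function.Injective fun i => (ρ (i, 0)).1 := by
    intro i j hij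
    dsimp only at hij
    by_cases hb : (ρ (j, 0)).2 = (ρ (i, 0)).2
    · exact congrArg Prod.fst (ρ.injective (Prod.ext hij hb.symm))
    · have hb' : (ρ (j, 0)).2 = (ρ (i, 1)).2 := by
        rcases h2 i with hi | hi <;> rcases h2 j with hj | hj <;> grind
      have := ρ.injective (Prod.ext (hij.symm.trans (h1 i)) hb')
      simpa using congrArg Prod.snd this
  let π : Equiv.Perm (Fin n) := Equiv.ofBijective _ (Finite.injective_iff_bijective.mp hinj)
  have hπ : ∀ i, π i = (ρ (i, 0)).1 := fun i => rfl
  let q : Fin n → Equiv.Perm (Fin 2) := fun i =>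
    if (ρ (i, 0)).2 = 0 then 1 else Equiv.swap 0 1
  -- `ρ` is a permutation `π` of the pairs after flips inside pairs. In the sign, `π` counts twice,
  -- once for each member of a pair, so only the flips contribute.
  have hρ : ρ = Equiv.prodCongrLeft (fun _ : Fin 2 => π) * Equiv.prodCongrRight q := by
    refine Equiv.ext ?_
    rintro ⟨i, b⟩
    refine Prod.ext ?_ ?_
    · fin_cases b
      · simp [hπ]
      · simp [hπ, h1]
    · have := h2 i
      fin_cases b <;> by_cases h0 : (ρ (i, 0)).2 = 0 <;> simp_all [q]
  have hsign : Equiv.Perm.sign ρ = ∏ i, Equiv.Perm.sign (q i) := by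
    conv_lhs => rw [hρ]
    rw [map_mul, Equiv.Perm.sign_prodCongrLeft, Equiv.Perm.sign_prodCongrRight,
      Fin.prod_univ_two, Int.units_mul_self, one_mul]
  rw [hsign, Units.coe_prod]
  refine Finset.prod_congr rfl fun i _ => ?_
  rcases h2 i with hi | hi
  · simp [q, symplecticSign, h1 i, hi]
  · simp [q, symplecticSign, h1 i, hi]

/-- The indexing of a frame by the Reeb direction and the symplectic pairs. -/
def pairEquiv (n : ℕ) : Fin (2 * n + 1) ≃ Option (Fin n × Fin 2) :=
  (finSuccEquiv (2 * n)).trans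
    (Equiv.optionCongr ((finCongr (Nat.mul_comm 2 n)).trans finProdFinEquiv.symm))

theorem pairEquiv_symm_none (n : ℕ) : (pairEquiv n).symm none = 0 := by
  rw [Equiv.symm_apply_eq, pairEquiv, Equiv.trans_apply, finSuccEquiv_zero,
    Equiv.optionCongr_apply, Option.map_none]

theorem pairEquiv_symm_some {n : ℕ} (i : Fin n) (b : Fin 2) :
    (pairEquiv n).symm (some (i, b)) = ⟨2 * i + 1 + b, by omega⟩ := by
  rw [Equiv.symm_apply_eq]
  have h : (⟨2 * i + 1 + b, by omega⟩ : Fin (2 * n + 1)) =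
      Fin.succ ⟨2 * i + b, by omega⟩ := Fin.ext (by simp; omega)
  rw [h, pairEquiv, Equiv.trans_apply, finSuccEquiv_succ, Equiv.optionCongr_apply,
    Option.map_some, Equiv.trans_apply, Option.some_inj, eq_comm, Equiv.symm_apply_eq]
  apply Fin.ext
  simp [finProdFinEquiv, add_comm]

/-- The form is evaluated on the Reeb vector followed by a symplectic basis of `ker a`. No term of
the sum over permutations is negative and the identity contributes `1`, so no count of the nonzero
terms is needed. -/
theorem IsContactPair.exists_contactTopForm_ne_zero {n : ℕ} {a : V →ₗ[ℝ] ℝ}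
    {B : LinearMap.BilinForm ℝ V} (h : IsContactPair a B) (hB : B.IsAlt)
    (hV : Module.finrank ℝ V = 2 * n + 1) : ∃ v, contactTopForm n a B v ≠ 0 := by
  obtain ⟨z, haz, hBz⟩ := h.exists_reeb hB (by rw [hV]; exact odd_two_mul_add_one n)
  have hBz' : ∀ w, B w z = 0 := fun w => by rw [← hB.neg_eq, hBz, neg_zero]
  obtain ⟨e, f, hae, haf, hee, hff, hef⟩ := h.exists_symplectic_family hB haz hBz hV n le_rfl
  have hfe : ∀ i l, B (f i) (e l) = if i = l then -1 else 0 := fun i l => by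
    rw [← hB.neg_eq, hef]
    by_cases hil : i = l <;> simp [hil, eq_comm]
  let u : Fin n × Fin 2 → V := fun p => if p.2 = 0 then e p.1 else f p.1
  have hau : ∀ p, a (u p) = 0 := fun p => by
    by_cases hp : p.2 = 0 <;> simp [u, hp, hae, haf]
  have hBu : ∀ p q, B (u p) (u q) = symplecticSign p q := by
    rintro ⟨i, b⟩ ⟨l, c⟩
    fin_cases b <;> fin_cases c <;> by_cases hil : i = l <;>
      simp [u, symplecticSign, hee, hff, hef, hfe, hil]
  let o : Option (Fin n × Fin 2) → V := fun p => p.elim z u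
  have hprod : ∀ σ : Equiv.Perm (Fin (2 * n + 1)),
      contactProduct n a B (fun i => o (pairEquiv n (σ i))) =
        a (o (((pairEquiv n).permCongr σ) none)) *
          ∏ i : Fin n, B (o ((pairEquiv n).permCongr σ (some (i, 0))))
            (o ((pairEquiv n).permCongr σ (some (i, 1)))) := by
    intro σ
    simp only [contactProduct, Equiv.permCongr_apply, pairEquiv_symm_none, pairEquiv_symm_some]
    rfl
  have hnonneg : ∀ σ : Equiv.Perm (Fin (2 * n + 1)), 0 ≤ ((Equiv.Perm.sign σ : ℤ) : ℝ) *
      contactProduct n a B (fun i => o (pairEquiv n (σ i))) := by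
    intro σ
    rw [hprod, ← Equiv.Perm.sign_permCongr (pairEquiv n) σ]
    set τ := (pairEquiv n).permCongr σ
    -- If the Reeb vector leaves the first slot, `a` is evaluated on a vector of its kernel and the
    -- term is zero. Otherwise the term is the sign of `ρ` times a product of pairings: zero, or a
    -- square because that product equals the sign.
    by_cases hτ : τ none = none
    · have hsome : ∀ p, τ (some p) = some (Equiv.removeNone τ p) := fun p =>
        (Equiv.removeNone_some τ (Option.ne_none_iff_exists'.mp fun hp => by
          simpa using τ.injective (hp.trans hτ.symm))).symm
      have hτ' : τ = Equiv.optionCongr (Equiv.removeNone τ) := by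
        refine Equiv.ext fun p => ?_
        cases p with
        | none => simp only [hτ, Equiv.optionCongr_apply, Option.map_none]
        | some p => rw [hsome, Equiv.optionCongr_apply, Option.map_some]
      set ρ := Equiv.removeNone τ
      have hsign : Equiv.Perm.sign τ = Equiv.Perm.sign ρ := by
        conv_lhs => rw [hτ']
        exact Equiv.optionCongr_sign _
      rw [hsign, hτ]
      simp only [hsome, o, Option.elim, haz, one_mul, hBu]
      by_cases hne : ∀ i, symplecticSign (ρ (i, 0)) (ρ (i, 1)) ≠ 0
      · rw [sign_eq_prod_symplecticSign ρ hne]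
        push_cast
        exact mul_self_nonneg _
      · push Not at hne
        obtain ⟨i, hi⟩ := hne
        rw [Finset.prod_eq_zero (Finset.mem_univ i) (by simp [hi]), mul_zero]
    · obtain ⟨p, hp⟩ := Option.ne_none_iff_exists'.mp hτ
      simp [hp, o, hau]
  refine ⟨fun i => o (pairEquiv n i), ne_of_gt ?_⟩
  rw [contactTopForm_apply]
  refine Finset.sum_pos' (fun σ _ => hnonneg σ) ⟨1, Finset.mem_univ _, ?_⟩
  rw [hprod]
  have : (pairEquiv n).permCongr 1 = 1 := by ext; simp
  rw [this]
  simp [o, haz, hBu, symplecticSign]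

end LinearAlgebra

end ContactDirac

/-! ### Smooth 1-forms, and naturality of the exterior derivative. -/

namespace ContactDirac

section Forms

open Topology

variable {d : ℕ} {M : Type*} [TopologicalSpace M] [ChartedSpace (EuclideanSpace ℝ (Fin d)) M]
  [IsManifold (𝓡 d) ∞ M]

instance : IsManifold (𝓡 d) 1 M := IsManifold.of_le (n := ∞) (by simp)

/-- A 1-form read in the preferred trivialization of the tangent bundle at `x₀`. -/
noncomputable def OneForm.inTrivialization (α : OneForm d M) (x₀ x : M) :
    EuclideanSpace ℝ (Fin d) →L[ℝ] ℝ :=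
  (α x).comp ((trivializationAt (EuclideanSpace ℝ (Fin d)) (TangentSpace (𝓡 d)) x₀).symmL ℝ x)

theorem OneForm.isSmooth_iff (α : OneForm d M) :
    α.IsSmooth ↔ ∀ x₀, ContMDiffAt (𝓡 d) 𝓘(ℝ, EuclideanSpace ℝ (Fin d) →L[ℝ] ℝ) ∞
      (α.inTrivialization x₀) x₀ := by
  refine forall_congr' fun x₀ => ?_
  rw [contMDiffAt_hom_bundle]
  refine (and_iff_right contMDiffAt_id).trans ?_
  refine Iff.of_eq (congrArg (fun F => ContMDiffAt _ _ _ F x₀) (funext fun x => ?_))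
  ext v
  simp [ContinuousLinearMap.inCoordinates, OneForm.inTrivialization]

/-- The inverse of the tangent trivialization is the derivative of the inverse chart. This links
smoothness, defined in trivializations, with `extDeriv`, defined in charts. -/
theorem OneForm.inChart_eq (α : OneForm d M) (x₀ : M) {y : EuclideanSpace ℝ (Fin d)}
    (hy : y ∈ (extChartAt (𝓡 d) x₀).target) :
    α.inChart x₀ y = ContinuousAlternatingMap.ofSubsingleton ℝ (EuclideanSpace ℝ (Fin d)) ℝ
      (0 : Fin 1) (α.inTrivialization x₀ ((extChartAt (𝓡 d) x₀).symm y)) := by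
  have hx : (extChartAt (𝓡 d) x₀).symm y ∈ (chartAt (EuclideanSpace ℝ (Fin d)) x₀).source := by
    rw [← extChartAt_source (𝓡 d)]
    exact (extChartAt (𝓡 d) x₀).map_target hy
  have h := TangentBundle.symmL_trivializationAt (I := 𝓡 d) hx
  rw [(extChartAt (𝓡 d) x₀).right_inv hy, ModelWithCorners.range_eq_univ, mfderivWithin_univ] at h
  rw [OneForm.inChart, OneForm.inTrivialization, h]

theorem OneForm.IsSmooth.differentiableAt_inChart {α : OneForm d M} (hα : α.IsSmooth) (x₀ : M) :
    DifferentiableAt ℝ (α.inChart x₀) (extChartAt (𝓡 d) x₀ x₀) := by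
  have h1 := α.isSmooth_iff.mp hα x₀
  have h2 : ContMDiffAt 𝓘(ℝ, EuclideanSpace ℝ (Fin d))
      𝓘(ℝ, EuclideanSpace ℝ (Fin d) →L[ℝ] ℝ) ∞
      (α.inTrivialization x₀ ∘ (extChartAt (𝓡 d) x₀).symm) (extChartAt (𝓡 d) x₀ x₀) := by
    refine ContMDiffAt.comp _ (by rwa [extChartAt_to_inv]) ?_
    exact contMDiffOn_extChartAt_symm x₀ |>.contMDiffAt
      (extChartAt_target_mem_nhds x₀)
  have h3 := (contMDiffAt_iff_contDiffAt.mp h2).differentiableAt (by simp)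
  have h4 : DifferentiableAt ℝ (fun y => ContinuousAlternatingMap.ofSubsingletonLIE (𝕜 := ℝ)
      (E := EuclideanSpace ℝ (Fin d)) (F := ℝ) (0 : Fin 1)
        ((α.inTrivialization x₀ ∘ (extChartAt (𝓡 d) x₀).symm) y)) (extChartAt (𝓡 d) x₀ x₀) :=
    (LinearIsometryEquiv.differentiable _).differentiableAt.comp _ h3
  refine h4.congr_of_eventuallyEq ?_
  filter_upwards [extChartAt_target_mem_nhds (I := 𝓡 d) x₀] with y hy
  exact α.inChart_eq x₀ hy

-- All tangent spaces are copies of one Euclidean space, so base point and vector can be replaced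
-- together without a dependent rewrite.
omit [IsManifold (𝓡 d) ∞ M] in
theorem OneForm.apply_congr (α : OneForm d M) {x y : M} (h : x = y)
    {v w : EuclideanSpace ℝ (Fin d)} (hvw : v = w) :
    (α x : EuclideanSpace ℝ (Fin d) →L[ℝ] ℝ) v = (α y : EuclideanSpace ℝ (Fin d) →L[ℝ] ℝ) w := by
  subst h hvw
  rfl

variable {e : ℕ} {N : Type*} [TopologicalSpace N] [ChartedSpace (EuclideanSpace ℝ (Fin e)) N]
  [IsManifold (𝓡 e) ∞ N]

theorem OneForm.IsSmooth.pullback {α : OneForm d M} (hα : α.IsSmooth) {j : N → M}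
    (hj : ContMDiff (𝓡 e) (𝓡 d) ∞ j) : (α.pullback j : OneForm e N).IsSmooth := by
  rw [OneForm.isSmooth_iff]
  intro p
  have h1 : ContMDiffAt (𝓡 e) 𝓘(ℝ, EuclideanSpace ℝ (Fin d) →L[ℝ] ℝ) ∞
      (fun x => α.inTrivialization (j p) (j x)) p :=
    ContMDiffAt.comp p (α.isSmooth_iff.mp hα (j p)) (hj p)
  have h2 := ContMDiffAt.mfderiv_const (m := ∞) (hj p) (by simp)
  refine (h1.clm_comp h2).congr_of_eventuallyEq ?_
  have hb := hj.continuous.continuousAt.preimage_mem_nhds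
    ((trivializationAt (EuclideanSpace ℝ (Fin d)) (TangentSpace (𝓡 d)) (j p)).open_baseSet.mem_nhds
      (FiberBundle.mem_baseSet_trivializationAt' (j p)))
  filter_upwards [hb] with x hx
  ext v
  simp only [inTangentCoordinates, ContinuousLinearMap.inCoordinates, OneForm.inTrivialization,
    OneForm.pullback, ContinuousLinearMap.comp_apply, id_eq]
  rw [Bundle.Trivialization.symmL_continuousLinearMapAt _ hx]

/-- With `h` the map `j` read in charts, the local expression of the pullback is, near `ψ p`, the
Euclidean pullback by `h` of the local expression of `α`; the Euclidean identity `d h^* = h^* d`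
then applies. -/
theorem OneForm.IsSmooth.extDeriv_pullback {α : OneForm d M} (hα : α.IsSmooth) {j : N → M}
    (hj : ContMDiff (𝓡 e) (𝓡 d) ∞ j) (p : N) (v w : TangentSpace (𝓡 e) p) :
    (α.pullback j : OneForm e N).extDeriv p ![v, w] =
      α.extDeriv (j p) ![mfderiv (𝓡 e) (𝓡 d) j p v, mfderiv (𝓡 e) (𝓡 d) j p w] := by
  set φ := extChartAt (𝓡 d) (j p)
  set ψ := extChartAt (𝓡 e) p
  set h : EuclideanSpace ℝ (Fin e) → EuclideanSpace ℝ (Fin d) := φ ∘ j ∘ ψ.symm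
  have hψ : ContMDiffAt 𝓘(ℝ, EuclideanSpace ℝ (Fin e)) (𝓡 e) ∞ ψ.symm (ψ p) :=
    (contMDiffOn_extChartAt_symm p).contMDiffAt (extChartAt_target_mem_nhds p)
  have hsmooth : ContDiffAt ℝ ∞ h (ψ p) := by
    rw [← contMDiffAt_iff_contDiffAt]
    refine ContMDiffAt.comp _ ?_ (ContMDiffAt.comp _ hj.contMDiffAt hψ)
    simp only [Function.comp_apply, ψ, extChartAt_to_inv]
    exact contMDiffAt_extChartAt
  have hp : h (ψ p) = φ (j p) := by simp [h, ψ]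
  have hchart : (α.pullback j : OneForm e N).inChart p =ᶠ[𝓝 (ψ p)]
      fun y => (α.inChart (j p) (h y)).compContinuousLinearMap (fderiv ℝ h y) := by
    have hcont : ContinuousAt (j ∘ ψ.symm) (ψ p) :=
      (hj.continuous.continuousAt).comp hψ.continuousAt
    have hmem : φ.source ∈ 𝓝 ((j ∘ ψ.symm) (ψ p)) := by
      simp only [Function.comp_apply, ψ, extChartAt_to_inv]
      exact extChartAt_source_mem_nhds (j p)
    filter_upwards [extChartAt_target_mem_nhds (I := 𝓡 e) p, hcont.preimage_mem_nhds hmem]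
      with y hy hjy
    have hjy' : j (ψ.symm y) ∈ φ.source := hjy
    have hd1 : MDifferentiableAt 𝓘(ℝ, EuclideanSpace ℝ (Fin e)) (𝓡 e) ψ.symm y :=
      (((contMDiffOn_extChartAt_symm (n := ∞) p).contMDiffAt
        ((isOpen_extChartAt_target p).mem_nhds hy))).mdifferentiableAt (by simp)
    have hd2 : MDifferentiableAt (𝓡 e) (𝓡 d) j (ψ.symm y) :=
      hj.contMDiffAt.mdifferentiableAt (by simp)
    have hd3 : MDifferentiableAt (𝓡 d) 𝓘(ℝ, EuclideanSpace ℝ (Fin d)) φ (j (ψ.symm y)) :=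
      mdifferentiableAt_extChartAt (by simpa [φ, extChartAt_source] using hjy')
    have hd4 : MDifferentiableAt 𝓘(ℝ, EuclideanSpace ℝ (Fin d)) (𝓡 d) φ.symm (h y) :=
      (((contMDiffOn_extChartAt_symm (n := ∞) (j p)).contMDiffAt
        ((isOpen_extChartAt_target (j p)).mem_nhds (φ.map_source hjy')))).mdifferentiableAt
          (by simp)
    have hdh : MDifferentiableAt 𝓘(ℝ, EuclideanSpace ℝ (Fin e))
        𝓘(ℝ, EuclideanSpace ℝ (Fin d)) h y := hd3.comp y (hd2.comp y hd1)
    have hinv : φ.symm (h y) = j (ψ.symm y) := φ.left_inv hjy'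
    have hcomp : (mfderiv 𝓘(ℝ, EuclideanSpace ℝ (Fin d)) (𝓡 d) φ.symm (h y)).comp
        (mfderiv 𝓘(ℝ, EuclideanSpace ℝ (Fin e)) 𝓘(ℝ, EuclideanSpace ℝ (Fin d)) h y) =
        (mfderiv (𝓡 e) (𝓡 d) j (ψ.symm y)).comp
          (mfderiv 𝓘(ℝ, EuclideanSpace ℝ (Fin e)) (𝓡 e) ψ.symm y) := by
      rw [← mfderiv_comp y hd4 hdh, ← mfderiv_comp y hd2 hd1]
      refine Filter.EventuallyEq.mfderiv_eq ?_
      have hcont' : ContinuousAt (j ∘ ψ.symm) y :=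
        (hj.continuous.continuousAt).comp hd1.continuousAt
      filter_upwards [hcont'.preimage_mem_nhds
        ((isOpen_extChartAt_source (j p)).mem_nhds hjy')] with z hz
      exact φ.left_inv hz
    ext u
    have := congrArg (fun L => L (u 0)) hcomp
    simp only [mfderiv_eq_fderiv] at this
    exact (α.apply_congr hinv this).symm
  -- The chain rule for `h ∘ ψ = φ ∘ j` near `p` matches the chart differentials used to transport
  -- both exterior derivatives back.
  have hvec : ∀ u : TangentSpace (𝓡 e) p,
      fderiv ℝ h (ψ p) (mfderiv (𝓡 e) 𝓘(ℝ, EuclideanSpace ℝ (Fin e)) ψ p u) =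
        mfderiv (𝓡 d) 𝓘(ℝ, EuclideanSpace ℝ (Fin d)) φ (j p) (mfderiv (𝓡 e) (𝓡 d) j p u) := by
    intro u
    have hd1 : MDifferentiableAt (𝓡 e) 𝓘(ℝ, EuclideanSpace ℝ (Fin e)) ψ p :=
      mdifferentiableAt_extChartAt (mem_chart_source _ p)
    have hd2 : MDifferentiableAt (𝓡 d) 𝓘(ℝ, EuclideanSpace ℝ (Fin d)) φ (j p) :=
      mdifferentiableAt_extChartAt (mem_chart_source _ (j p))
    have hd3 : MDifferentiableAt 𝓘(ℝ, EuclideanSpace ℝ (Fin e))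
        𝓘(ℝ, EuclideanSpace ℝ (Fin d)) h (ψ p) :=
      (hsmooth.differentiableAt (by simp)).mdifferentiableAt
    rw [← mfderiv_eq_fderiv]
    have hcomp : (mfderiv 𝓘(ℝ, EuclideanSpace ℝ (Fin e)) 𝓘(ℝ, EuclideanSpace ℝ (Fin d)) h
        (ψ p)).comp (mfderiv (𝓡 e) 𝓘(ℝ, EuclideanSpace ℝ (Fin e)) ψ p) =
        (mfderiv (𝓡 d) 𝓘(ℝ, EuclideanSpace ℝ (Fin d)) φ (j p)).comp
          (mfderiv (𝓡 e) (𝓡 d) j p) := by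
      rw [← mfderiv_comp p hd3 hd1, ← mfderiv_comp p hd2 (hj.contMDiffAt.mdifferentiableAt
        (by simp))]
      refine Filter.EventuallyEq.mfderiv_eq ?_
      filter_upwards [extChartAt_source_mem_nhds (I := 𝓡 e) p] with z hz
      simp only [Function.comp_apply, h]
      rw [ψ.left_inv hz]
    exact congrArg (fun L => L u) hcomp
  have hext := hchart.extDeriv_eq.trans (_root_.extDeriv_pullback (r := ∞)
    (show DifferentiableAt ℝ (α.inChart (j p)) (h (ψ p)) from
      hp ▸ hα.differentiableAt_inChart (j p)) hsmooth
      (by rw [minSmoothness_of_isRCLikeNormedField]; exact ENat.LEInfty.out))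
  rw [OneForm.extDeriv, OneForm.extDeriv, hext, hp]
  refine congrArg (_root_.extDeriv (α.inChart (j p)) (φ (j p))) (funext fun i => ?_)
  fin_cases i
  · exact hvec v
  · exact hvec w

end Forms

end ContactDirac

/-! ### Regular level sets as embedded submanifolds. -/

namespace ContactDirac

open Topology Set

/-- The inverse function theorem, producing a diffeomorphism between open sets. -/
theorem exists_openPartialHomeomorph_contDiffOn {E : Type*} [NormedAddCommGroup E]
    [NormedSpace ℝ E] [CompleteSpace E] {f : E → E} {U : Set E} (hU : IsOpen U)
    (hf : ContDiffOn ℝ ∞ f U) {a : E} (ha : a ∈ U) {f' : E ≃L[ℝ] E}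
    (hf' : HasFDerivAt f (f' : E →L[ℝ] E) a) :
    ∃ Ψ : OpenPartialHomeomorph E E, a ∈ Ψ.source ∧ Ψ.source ⊆ U ∧ EqOn Ψ f Ψ.source ∧
      ContDiffOn ℝ ∞ Ψ Ψ.source ∧ ContDiffOn ℝ ∞ Ψ.symm Ψ.target := by
  have hfa : ContDiffAt ℝ ∞ f a := hf.contDiffAt (hU.mem_nhds ha)
  let Ψ₀ := hfa.toOpenPartialHomeomorph f hf' (by simp)
  have hΨ₀ : ⇑Ψ₀ = f := hfa.toOpenPartialHomeomorph_coe hf' (by simp)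
  -- Smoothness of the inverse at every point of the target requires an invertible derivative on the
  -- whole source, an open condition.
  let W : Set E := U ∩ fderiv ℝ f ⁻¹' range ((↑) : (E ≃L[ℝ] E) → E →L[ℝ] E)
  have hW : IsOpen W := (hf.continuousOn_fderiv_of_isOpen hU (by simp)).isOpen_inter_preimage hU
    ContinuousLinearEquiv.isOpen
  have haW : a ∈ W := ⟨ha, f', hf'.fderiv.symm⟩
  let Ψ := Ψ₀.restrOpen W hW
  have hΨ : ⇑Ψ = f := hΨ₀
  have hsource : Ψ.source = Ψ₀.source ∩ W := Ψ₀.restrOpen_source W hW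
  have hWs : Ψ.source ⊆ W := hsource ▸ inter_subset_right
  have hsub : Ψ.source ⊆ U := hWs.trans inter_subset_left
  refine ⟨Ψ, ?_, hsub, fun x _ => congrFun hΨ x, ?_, fun y hy => ?_⟩
  · rw [hsource]
    exact ⟨hfa.mem_toOpenPartialHomeomorph_source hf' (by simp), haW⟩
  · rw [hΨ]
    exact hf.mono hsub
  · have hx : Ψ.symm y ∈ W := hWs (Ψ.map_target hy)
    have hcd : ContDiffAt ℝ ∞ f (Ψ.symm y) := hf.contDiffAt (hU.mem_nhds hx.1)
    obtain ⟨A, hA⟩ := hx.2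
    refine (Ψ.contDiffAt_symm (f₀' := A) hy ?_ ?_).contDiffWithinAt
    · rw [hΨ, hA]
      exact (hcd.differentiableAt (by simp)).hasFDerivAt
    · rwa [hΨ]

/-- A surjective linear map can be completed to an isomorphism by a linear map to a space of the
dimension of its kernel. -/
theorem exists_prod_injective {E E' F : Type*} [NormedAddCommGroup E] [NormedSpace ℝ E]
    [FiniteDimensional ℝ E] [NormedAddCommGroup E'] [NormedSpace ℝ E'] [FiniteDimensional ℝ E']
    [NormedAddCommGroup F] [NormedSpace ℝ F] [FiniteDimensional ℝ F] (e : (E' × F) ≃L[ℝ] E)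
    {A : E →L[ℝ] F} (hA : Function.Surjective A) :
    ∃ L : E →L[ℝ] E', Function.Injective fun x => (L x, A x) := by
  have h1 := A.toLinearMap.finrank_range_add_finrank_ker
  rw [LinearMap.range_eq_top.mpr hA, finrank_top, ← e.toLinearEquiv.finrank_eq,
    Module.finrank_prod] at h1
  obtain ⟨P, hP⟩ := A.toLinearMap.ker.subtype.exists_leftInverse_of_injective
    (Submodule.ker_subtype _)
  let κ : A.toLinearMap.ker ≃ₗ[ℝ] E' := LinearEquiv.ofFinrankEq _ _ (by omega)
  refine ⟨LinearMap.toContinuousLinearMap (κ.toLinearMap ∘ₗ P), fun x y hxy => ?_⟩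
  simp only [Prod.mk.injEq] at hxy
  have hk : x - y ∈ A.toLinearMap.ker := by simp [hxy.2]
  have h2 : P (x - y) = ⟨x - y, hk⟩ := by simpa using LinearMap.congr_fun hP ⟨x - y, hk⟩
  have h3 : P (x - y) = 0 := by
    apply κ.injective
    simpa [sub_eq_zero] using hxy.1
  exact sub_eq_zero.mp (congrArg Subtype.val (h2.symm.trans h3))

section Slice

variable {d e k : ℕ} {M : Type*} [TopologicalSpace M] [ChartedSpace (EuclideanSpace ℝ (Fin d)) M]
  (ε : (EuclideanSpace ℝ (Fin e) × EuclideanSpace ℝ (Fin k)) ≃L[ℝ] EuclideanSpace ℝ (Fin d))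

/-- Charts around a regular point adapted to the level sets of a map. -/
theorem exists_slice_chart [IsManifold (𝓡 d) ∞ M] {g : M → EuclideanSpace ℝ (Fin k)}
    (hg : ContMDiff (𝓡 d) 𝓘(ℝ, EuclideanSpace ℝ (Fin k)) ∞ g) (p : M)
    (hp : Function.Surjective (mvfderiv (𝓡 d) g p)) :
    ∃ Φ ∈ IsManifold.maximalAtlas (𝓡 d) ∞ M, p ∈ Φ.source ∧
      ∀ x ∈ Φ.source, (ε.symm (Φ x)).2 = g x := by
  let φ := chartAt (EuclideanSpace ℝ (Fin d)) p
  let h : EuclideanSpace ℝ (Fin d) → EuclideanSpace ℝ (Fin k) := g ∘ φ.symm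
  have hh : ContDiffOn ℝ ∞ h φ.target := by
    rw [← contMDiffOn_iff_contDiffOn]
    exact hg.comp_contMDiffOn contMDiffOn_chart_symm
  have hpt : φ p ∈ φ.target := mem_chart_target _ p
  have hdiff : DifferentiableAt ℝ h (φ p) :=
    (hh.contDiffAt (φ.open_target.mem_nhds hpt)).differentiableAt (by simp)
  have hA : Function.Surjective (fderiv ℝ h (φ p)) := by
    have h1 : mvfderiv (𝓡 d) g p = fderiv ℝ h (φ p) := by
      rw [(hg.mdifferentiableAt (by simp)).mvfderiv]
      simp [h, φ, writtenInExtChartAt, extChartAt, fderivWithin_univ, chartAt_self_eq]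
      rfl
    rwa [h1] at hp
  obtain ⟨L, hL⟩ := exists_prod_injective ε hA
  -- The linear map `L` completes `h` to a local diffeomorphism that has `h` as its last
  -- coordinates.
  let f : EuclideanSpace ℝ (Fin d) → EuclideanSpace ℝ (Fin d) := fun y => ε (L y, h y)
  have hf : ContDiffOn ℝ ∞ f φ.target :=
    ε.contDiff.comp_contDiffOn (L.contDiff.contDiffOn.prodMk hh)
  let D : EuclideanSpace ℝ (Fin d) →L[ℝ] EuclideanSpace ℝ (Fin d) :=
    (ε : _ →L[ℝ] _).comp (L.prod (fderiv ℝ h (φ p)))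
  have hDinj : Function.Injective D := ε.injective.comp hL
  let f' : EuclideanSpace ℝ (Fin d) ≃L[ℝ] EuclideanSpace ℝ (Fin d) :=
    (LinearEquiv.ofInjectiveEndo D.toLinearMap hDinj).toContinuousLinearEquiv
  have hf' : HasFDerivAt f (f' : _ →L[ℝ] _) (φ p) := by
    have : (f' : EuclideanSpace ℝ (Fin d) →L[ℝ] EuclideanSpace ℝ (Fin d)) = D := by
      ext1 x; rfl
    rw [this]
    exact ε.hasFDerivAt.comp _ (L.hasFDerivAt.prodMk hdiff.hasFDerivAt)
  obtain ⟨Ψ, haΨ, hΨU, hΨf, hΨ, hΨ'⟩ :=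
    exists_openPartialHomeomorph_contDiffOn φ.open_target hf hpt hf'
  refine ⟨φ ≫ₕ Ψ, ?_, ?_, fun x hx => ?_⟩
  · refine OpenPartialHomeomorph.mem_maximalAtlas_of_contMDiffOn _ ?_ ?_
    · exact (contMDiffOn_iff_contDiffOn.mpr hΨ).comp
        (contMDiffOn_chart.mono (by simp [φ])) (by simp [φ])
    · exact contMDiffOn_chart_symm.comp ((contMDiffOn_iff_contDiffOn.mpr hΨ').mono (by simp))
        (by simp [φ])
  · simpa [φ] using haΨ
  · have hx' : x ∈ φ.source ∧ φ x ∈ Ψ.source := by simpa using hx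
    rw [OpenPartialHomeomorph.trans_apply, hΨf hx'.2]
    simp [f, h, φ.left_inv hx'.1]

variable {S : Set M}

/-- The chart of a subset cut out in the chart `Φ` by the vanishing of the last coordinates. -/
noncomputable def sliceChart (p : S) (Φ : OpenPartialHomeomorph M (EuclideanSpace ℝ (Fin d)))
    (hΦ : ∀ x ∈ Φ.source, x ∈ S ↔ (ε.symm (Φ x)).2 = 0) :
    OpenPartialHomeomorph S (EuclideanSpace ℝ (Fin e)) :=
  have hmem : ∀ y, ε (y, 0) ∈ Φ.target → Φ.symm (ε (y, 0)) ∈ S := fun y hy => by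
    rw [hΦ _ (Φ.map_target hy), Φ.right_inv hy]
    simp
  open Classical in
  { toFun x := (ε.symm (Φ x)).1
    -- The value `p` is a dummy: on the target, the point `Φ.symm (ε (y, 0))` always lies in `S`.
    invFun y := if h : Φ.symm (ε (y, 0)) ∈ S then ⟨_, h⟩ else p
    source := Subtype.val ⁻¹' Φ.source
    target := (fun y => ε (y, 0)) ⁻¹' Φ.target
    map_source' x hx := by
      have h0 := (hΦ x hx).mp x.2
      have h1 : ((ε.symm (Φ x)).1, (0 : EuclideanSpace ℝ (Fin k))) = ε.symm (Φ x) :=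
        Prod.ext rfl h0.symm
      simp only [mem_preimage, h1, ε.apply_symm_apply]
      exact Φ.map_source hx
    map_target' y hy := by
      simp only [mem_preimage, dif_pos (hmem y hy)]
      exact Φ.map_target hy
    left_inv' x hx := by
      have h0 := (hΦ x hx).mp x.2
      have h1 : ((ε.symm (Φ x)).1, (0 : EuclideanSpace ℝ (Fin k))) = ε.symm (Φ x) :=
        Prod.ext rfl h0.symm
      have h2 : Φ.symm (ε ((ε.symm (Φ x)).1, 0)) = x := by
        rw [h1, ε.apply_symm_apply, Φ.left_inv hx]
      simp only [h2, x.2, dif_pos]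
    right_inv' y hy := by
      simp only [dif_pos (hmem y hy)]
      rw [Φ.right_inv hy]
      simp
    open_source := Φ.open_source.preimage continuous_subtype_val
    open_target := Φ.open_target.preimage (by fun_prop)
    continuousOn_toFun := continuous_fst.comp_continuousOn (ε.symm.continuous.comp_continuousOn
      (Φ.continuousOn.comp continuous_subtype_val.continuousOn fun _ h => h))
    continuousOn_invFun := by
      rw [IsInducing.subtypeVal.continuousOn_iff]
      have : ContinuousOn (fun y => Φ.symm (ε (y, 0))) ((fun y => ε (y, 0)) ⁻¹' Φ.target) :=
        Φ.continuousOn_symm.comp (Continuous.continuousOn (by fun_prop)) fun _ h => h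
      refine this.congr fun y hy => ?_
      simp only [Function.comp_apply, dif_pos (hmem y hy)] }

variable {ε} {p : S} {Φ : OpenPartialHomeomorph M (EuclideanSpace ℝ (Fin d))}
    {hΦ : ∀ x ∈ Φ.source, x ∈ S ↔ (ε.symm (Φ x)).2 = 0}

omit [ChartedSpace (EuclideanSpace ℝ (Fin d)) M] in
theorem sliceChart_symm_apply {y : EuclideanSpace ℝ (Fin e)}
    (hy : y ∈ (sliceChart ε p Φ hΦ).target) :
    ((sliceChart ε p Φ hΦ).symm y : M) = Φ.symm (ε (y, 0)) := by
  have hmem : Φ.symm (ε (y, 0)) ∈ S := by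
    rw [hΦ _ (Φ.map_target hy), Φ.right_inv hy]
    simp
  classical
  change ((if h : Φ.symm (ε (y, 0)) ∈ S then (⟨_, h⟩ : S) else p : S) : M) = _
  rw [dif_pos hmem]

/-- A subset that is covered by slice charts is an embedded submanifold. -/
theorem exists_isSmoothEmbedding_of_slice_charts
    (h : ∀ p ∈ S, ∃ Φ ∈ IsManifold.maximalAtlas (𝓡 d) ∞ M, p ∈ Φ.source ∧
      ∀ x ∈ Φ.source, x ∈ S ↔ (ε.symm (Φ x)).2 = 0) :
    ∃ _ : ChartedSpace (EuclideanSpace ℝ (Fin e)) S, IsManifold (𝓡 e) ∞ S ∧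
      Manifold.IsSmoothEmbedding (𝓡 e) (𝓡 d) ∞ (Subtype.val : S → M) := by
  choose Φ hΦmem hΦp hΦ using fun p : S => h p p.2
  let ψ : S → OpenPartialHomeomorph S (EuclideanSpace ℝ (Fin e)) :=
    fun p => sliceChart ε p (Φ p) (hΦ p)
  let cs : ChartedSpace (EuclideanSpace ℝ (Fin e)) S :=
    { atlas := range ψ
      chartAt := ψ
      mem_chart_source := hΦp
      chart_mem_atlas := mem_range_self }
  have hman : IsManifold (𝓡 e) ∞ S := by
    refine isManifold_of_contDiffOn _ _ _ ?_
    rintro _ _ ⟨p, rfl⟩ ⟨q, rfl⟩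
    -- Transition maps between slice charts are ambient transition maps restricted to vectors `(y,
    -- 0)` and projected to the first factor.
    have hT : ContDiffOn ℝ ∞ ((Φ p).symm ≫ₕ Φ q) ((Φ p).symm ≫ₕ Φ q).source :=
      contMDiffOn_iff_contDiffOn.mp (contMDiffOn_of_mem_contDiffGroupoid
        (IsManifold.compatible_of_mem_maximalAtlas (hΦmem p) (hΦmem q)))
    have hsource : ∀ y ∈ ((ψ p).symm ≫ₕ ψ q).source, y ∈ (ψ p).target ∧
        ε (y, 0) ∈ ((Φ p).symm ≫ₕ Φ q).source := by
      intro y hy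
      rw [OpenPartialHomeomorph.trans_source] at hy ⊢
      have h1 : ((ψ p).symm y : M) ∈ (Φ q).source := hy.2
      rw [sliceChart_symm_apply hy.1] at h1
      exact ⟨hy.1, hy.1, h1⟩
    have hsmooth : ContDiffOn ℝ ∞
        (fun y => (ε.symm (((Φ p).symm ≫ₕ Φ q) (ε (y, 0)))).1) ((ψ p).symm ≫ₕ ψ q).source :=
      contDiff_fst.comp_contDiffOn (ε.symm.contDiff.comp_contDiffOn (hT.comp
        (ε.contDiff.comp (contDiff_id.prodMk contDiff_const)).contDiffOn
        fun y hy => (hsource y hy).2))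
    simp only [modelWithCornersSelf_coe, modelWithCornersSelf_coe_symm, Function.id_comp,
      Function.comp_id, preimage_id, range_id, inter_univ]
    refine hsmooth.congr fun y hy => ?_
    rw [OpenPartialHomeomorph.trans_apply, OpenPartialHomeomorph.trans_apply,
      ← sliceChart_symm_apply (hsource y hy).1]
    rfl
  refine ⟨cs, hman, ?_, IsEmbedding.subtypeVal⟩
  refine Manifold.IsImmersionOfComplement.isImmersion (F := EuclideanSpace ℝ (Fin k)) fun p => ?_
  -- In the slice chart and the ambient chart, the inclusion is `y ↦ ε (y, 0)`, the normal form of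
  -- an immersion.
  refine Manifold.IsImmersionAtOfComplement.mk_of_charts ε (ψ p) (Φ p) (hΦp p) (hΦp p)
    (IsManifold.chart_mem_maximalAtlas p) (hΦmem p) (fun x hx => hx) fun y hy => ?_
  have hy' : y ∈ (ψ p).target := by simpa using hy
  have := sliceChart_symm_apply hy'
  simp only [Function.comp_apply, OpenPartialHomeomorph.extend_coe,
    OpenPartialHomeomorph.extend_coe_symm, modelWithCornersSelf_coe,
    modelWithCornersSelf_coe_symm, id_eq]
  rw [this, (Φ p).right_inv hy']

end Slice

/-- The derivative of an immersion is injective. -/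
theorem mfderiv_injective_of_isImmersion {d e : ℕ} {M N : Type*} [TopologicalSpace M]
    [ChartedSpace (EuclideanSpace ℝ (Fin d)) M] [IsManifold (𝓡 d) ∞ M] [TopologicalSpace N]
    [ChartedSpace (EuclideanSpace ℝ (Fin e)) N] [IsManifold (𝓡 e) ∞ N] {j : N → M}
    (hj : Manifold.IsImmersion (𝓡 e) (𝓡 d) ∞ j) (x : N) :
    Function.Injective (mfderiv (𝓡 e) (𝓡 d) j x) := by
  have h := hj.isImmersionAt x
  set ψ := h.domChart
  set Φ := h.codChart
  have hψx := h.mem_domChart_source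
  have hΦx := h.mem_codChart_source
  have hψ : MDifferentiableAt (𝓡 e) (𝓡 e) ψ x :=
    (contMDiffAt_of_mem_maximalAtlas h.domChart_mem_maximalAtlas hψx).mdifferentiableAt (by simp)
  have hΦ : MDifferentiableAt (𝓡 d) (𝓡 d) Φ (j x) :=
    (contMDiffAt_of_mem_maximalAtlas h.codChart_mem_maximalAtlas hΦx).mdifferentiableAt (by simp)
  have hψs : MDifferentiableAt (𝓡 e) (𝓡 e) ψ.symm (ψ x) :=
    (contMDiffAt_symm_of_mem_maximalAtlas h.domChart_mem_maximalAtlas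
      (ψ.map_source hψx)).mdifferentiableAt (by simp)
  have hjx : MDifferentiableAt (𝓡 e) (𝓡 d) j x := hj.contMDiff.contMDiffAt.mdifferentiableAt
    (by simp)
  let ι : EuclideanSpace ℝ (Fin e) →L[ℝ] EuclideanSpace ℝ (Fin d) :=
    (h.equiv : EuclideanSpace ℝ (Fin e) × h.complement →L[ℝ] EuclideanSpace ℝ (Fin d)).comp
       (ContinuousLinearMap.inl ℝ _ _)
  have hι : Function.Injective ι := h.equiv.injective.comp LinearMap.inl_injective
  -- In adapted charts `j` is the linear injection `ι`, and the differential of the chart `ψ` has a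
  -- left inverse.
  have hEq : Φ ∘ j =ᶠ[𝓝 x] ι ∘ ψ := by
    filter_upwards [ψ.open_source.mem_nhds hψx] with z hz
    have hz' : ψ z ∈ (ψ.extend (𝓡 e)).target := by simpa using ψ.map_source hz
    have := h.writtenInCharts hz'
    simp only [Function.comp_apply, OpenPartialHomeomorph.extend_coe,
      OpenPartialHomeomorph.extend_coe_symm, modelWithCornersSelf_coe,
      modelWithCornersSelf_coe_symm, id_eq] at this
    rwa [ψ.left_inv hz] at this
  have h1 := hEq.mfderiv_eq (I := 𝓡 e) (I' := 𝓡 d)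
  rw [mfderiv_comp x hΦ hjx, mfderiv_comp x (I' := 𝓡 e) ι.mdifferentiableAt hψ] at h1
  have h2 : (mfderiv (𝓡 e) (𝓡 e) ψ.symm (ψ x)).comp (mfderiv (𝓡 e) (𝓡 e) ψ x) =
      ContinuousLinearMap.id ℝ _ := by
    rw [← mfderiv_comp x hψs hψ, ← mfderiv_id]
    refine Filter.EventuallyEq.mfderiv_eq ?_
    filter_upwards [ψ.open_source.mem_nhds hψx] with z hz
    exact ψ.left_inv hz
  rw [injective_iff_map_eq_zero]
  intro v hv
  have h3 : ι (mfderiv (𝓡 e) (𝓡 e) ψ x v) = 0 := by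
    have := congrArg (fun L => L v) h1
    rw [mfderiv_eq_fderiv, ContinuousLinearMap.fderiv] at this
    exact this.symm.trans ((congrArg (mfderiv (𝓡 d) (𝓡 d) Φ (j x)) hv).trans (map_zero _))
  have h4 : mfderiv (𝓡 e) (𝓡 e) ψ x v = 0 := hι (h3.trans (map_zero ι).symm)
  have h5 := congrArg (fun L => L v) h2
  exact h5.symm.trans ((congrArg (mfderiv (𝓡 e) (𝓡 e) ψ.symm (ψ x)) h4).trans (map_zero _))

end ContactDirac

/-! ### Contact subspaces; pointwise calculus of Reeb and Hamiltonian vectors. -/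

namespace ContactDirac

section LinearAlgebra

variable {V ι : Type*} [AddCommGroup V] [Module ℝ V] [Fintype ι] [DecidableEq ι]

/-- Vectors with prescribed values under functionals `D i` whose matrix on `Y j` is invertible. -/
theorem exists_apply_sum_eq {D : ι → V →ₗ[ℝ] ℝ} {Y : ι → V}
    (hdet : (Matrix.of fun i j => D i (Y j)).det ≠ 0) (u : ι → ℝ) :
    ∃ c : ι → ℝ, ∀ i, D i (∑ j, c j • Y j) = u i := by
  set A := Matrix.of fun i j => D i (Y j)
  refine ⟨A⁻¹.mulVec u, fun i => ?_⟩
  have h : A.mulVec (A⁻¹.mulVec u) = u := by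
    rw [Matrix.mulVec_mulVec, Matrix.mul_nonsing_inv _ (isUnit_iff_ne_zero.mpr hdet),
      Matrix.one_mulVec]
  conv_rhs => rw [← h]
  simp [Matrix.mulVec, dotProduct, A, mul_comm]

/-- The common kernel of the `D i` is a contact subspace. -/
theorem IsContactPair.eq_zero_of_forall_mem_ker {a : V →ₗ[ℝ] ℝ} {B : LinearMap.BilinForm ℝ V}
    (h : IsContactPair a B) (hB : B.IsAlt) {D : ι → V →ₗ[ℝ] ℝ} {Y : ι → V}
    (hY : ∀ i w, B (Y i) w = -D i w) (hdet : (Matrix.of fun i j => D i (Y j)).det ≠ 0)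
    {v : V} (hv : ∀ i, D i v = 0) (hav : a v = 0)
    (hBv : ∀ w, (∀ i, D i w = 0) → B v w = 0) : v = 0 := by
  refine h v hav fun w => ?_
  -- Any `w` is a vector of the common kernel plus a combination of the `Y j`, and `v` is
  -- `B`-orthogonal to both parts.
  obtain ⟨c, hc⟩ := exists_apply_sum_eq hdet fun i => D i w
  have h1 : B v (w - ∑ j, c j • Y j) = 0 := hBv _ fun i => by rw [map_sub, hc, sub_self]
  have h2 : ∀ j, B v (Y j) = 0 := fun j => by rw [← hB.neg_eq, hY, hv, neg_zero, neg_zero]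
  simpa [h2] using h1

end LinearAlgebra

theorem update_pair_zero {V : Type*} (v w u : V) : Function.update ![v, w] 0 u = ![u, w] :=
  funext (Fin.forall_fin_two.mpr ⟨rfl, rfl⟩)

theorem update_pair_one {V : Type*} (v w u : V) : Function.update ![v, w] 1 u = ![v, u] :=
  funext (Fin.forall_fin_two.mpr ⟨rfl, rfl⟩)

section Pointwise

variable {d : ℕ} {M : Type*} [TopologicalSpace M] [ChartedSpace (EuclideanSpace ℝ (Fin d)) M]

instance (x : M) : FiniteDimensional ℝ (TangentSpace (𝓡 d) x) :=
  inferInstanceAs (FiniteDimensional ℝ (EuclideanSpace ℝ (Fin d)))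

theorem finrank_tangentSpace (x : M) : Module.finrank ℝ (TangentSpace (𝓡 d) x) = d :=
  finrank_euclideanSpace_fin (𝕜 := ℝ) (n := d)

/-- The exterior derivative of a 1-form at a point, as a bilinear form. -/
noncomputable def OneForm.bilin (α : OneForm d M) (x : M) :
    LinearMap.BilinForm ℝ (TangentSpace (𝓡 d) x) :=
  LinearMap.mk₂ ℝ (fun v w => α.extDeriv x ![v, w])
    (fun v v' w => by
      simpa only [update_pair_zero] using (α.extDeriv x).map_update_add ![v, w] 0 v v')
    (fun c v w => by
      simpa only [update_pair_zero] using (α.extDeriv x).map_update_smul ![v, w] 0 c v)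
    (fun v w w' => by
      simpa only [update_pair_one] using (α.extDeriv x).map_update_add ![v, w] 1 w w')
    (fun c v w => by
      simpa only [update_pair_one] using (α.extDeriv x).map_update_smul ![v, w] 1 c w)

theorem OneForm.bilin_apply (α : OneForm d M) (x : M) (v w : TangentSpace (𝓡 d) x) :
    α.bilin x v w = α.extDeriv x ![v, w] := rfl

theorem OneForm.bilin_isAlt (α : OneForm d M) (x : M) : (α.bilin x).IsAlt := fun v =>
  (α.extDeriv x).map_eq_zero_of_eq ![v, v] (i := 0) (j := 1) rfl (by simp)

/-- The contact condition at a point, as nondegeneracy of the pair `(α, dα)`. -/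
def IsContactAt (α : OneForm d M) (x : M) : Prop :=
  IsContactPair (α x).toLinearMap (α.bilin x)

theorem contactVolume_eq {n : ℕ} {M : Type*} [TopologicalSpace M]
    [ChartedSpace (EuclideanSpace ℝ (Fin (2 * n + 1))) M] (α : OneForm (2 * n + 1) M) (x : M)
    (v : Fin (2 * n + 1) → TangentSpace (𝓡 (2 * n + 1)) x) :
    contactVolume α x v = (1 / 2 ^ n) * contactTopForm n (α x).toLinearMap (α.bilin x) v := by
  rw [contactVolume, contactTopForm_apply]
  rfl

theorem isContactAt_iff {n : ℕ} {M : Type*} [TopologicalSpace M]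
    [ChartedSpace (EuclideanSpace ℝ (Fin (2 * n + 1))) M] (α : OneForm (2 * n + 1) M) (x : M) :
    IsContactAt α x ↔ ∃ v, contactVolume α x v ≠ 0 := by
  simp only [contactVolume_eq]
  constructor
  · intro h
    obtain ⟨v, hv⟩ := h.exists_contactTopForm_ne_zero (α.bilin_isAlt x) (finrank_tangentSpace x)
    exact ⟨v, mul_ne_zero (by positivity) hv⟩
  · rintro ⟨v, hv⟩
    exact .of_contactTopForm_ne_zero (α.bilin_isAlt x) (finrank_tangentSpace x)
      (right_ne_zero_of_mul hv)

variable {α : OneForm d M} {x : M}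

namespace IsContactAt

theorem isReebVector_reeb (h : IsContactAt α x) (hd : Odd d) : IsReebVector α x (reeb α x) :=
  Classical.epsilon_spec (p := IsReebVector α x)
    (h.exists_reeb (α.bilin_isAlt x) (by rwa [finrank_tangentSpace]))

theorem eq_reeb (h : IsContactAt α x) (hd : Odd d) {z : TangentSpace (𝓡 d) x}
    (hz : IsReebVector α x z) : z = reeb α x := by
  have hr := h.isReebVector_reeb hd
  exact h.eq_of_forall_eq (hz.1.trans hr.1.symm) fun w => (hz.2 w).trans (hr.2 w).symm

/-- The form `df - Z(f) α` vanishes on `Z`, so the choice made in `sharp` is a genuine solution.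
With `eq_contactHam`, these two equations characterize `Y_f`. -/
theorem contactHam_spec (h : IsContactAt α x) (hd : Odd d) (f : M → ℝ) :
    α x (contactHam α f x) = f x ∧ ∀ w, -α.bilin x (contactHam α f x) w =
      differential f x w - differential f x (reeb α x) * α x w := by
  have hr := h.isReebVector_reeb hd
  let η : TangentSpace (𝓡 d) x →L[ℝ] ℝ := differential f x - differential f x (reeb α x) • α x
  have hs : α x (sharp α x η) = 0 ∧ ∀ w, -α.extDeriv x ![sharp α x η, w] = η w :=
    Classical.epsilon_spec (p := fun v => α x v = 0 ∧ ∀ w, -α.extDeriv x ![v, w] = η w)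
      (h.exists_sharp (α.bilin_isAlt x) hr.1 hr.2 (η := η.toLinearMap) (by simp [η, hr.1]))
  refine ⟨?_, fun w => ?_⟩
  · rw [contactHam, map_add, hs.1, map_smul, hr.1, smul_eq_mul, mul_one, add_zero]
  · have h1 : α.bilin x (reeb α x) w = 0 := hr.2 w
    have h2 := hs.2 w
    rw [← OneForm.bilin_apply] at h2
    rw [contactHam, map_add, map_smul, LinearMap.add_apply, LinearMap.smul_apply, h1, smul_zero,
      zero_add, h2]
    simp [η]

theorem eq_contactHam (h : IsContactAt α x) (hd : Odd d) {f : M → ℝ} {v : TangentSpace (𝓡 d) x}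
    (hα : α x v = f x) (hv : ∀ w, -α.bilin x v w =
      differential f x w - differential f x (reeb α x) * α x w) : v = contactHam α f x := by
  have hs := h.contactHam_spec hd f
  exact h.eq_of_forall_eq (hα.trans hs.1.symm) fun w => neg_injective ((hv w).trans (hs.2 w).symm)

/-- The equation of `Y_f` evaluated on `Y_g`, plus that of `Y_g` evaluated on `Y_f`, has left side
zero because `dα` is skew; its right side is `[g, f] + [f, g]`. -/
theorem jacobiBracket_antisymm (h : IsContactAt α x) (hd : Odd d) (f g : M → ℝ) :
    jacobiBracket α f g x = -jacobiBracket α g f x := by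
  have hf := h.contactHam_spec hd f
  have hg := h.contactHam_spec hd g
  have h1 := hf.2 (contactHam α g x)
  have h2 := hg.2 (contactHam α f x)
  have h3 := (α.bilin_isAlt x).neg_eq (contactHam α f x) (contactHam α g x)
  rw [hg.1] at h1
  rw [hf.1] at h2
  simp only [jacobiBracket]
  linarith

theorem contactHam_one (h : IsContactAt α x) (hd : Odd d) :
    contactHam α (fun _ => 1) x = reeb α x := by
  have hr := h.isReebVector_reeb hd
  have h0 : differential (d := d) (fun _ : M => (1 : ℝ)) x = 0 := mvfderiv_const _
  refine (h.eq_contactHam hd hr.1 fun w => ?_).symm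
  rw [OneForm.bilin_apply, hr.2, h0]
  simp

theorem jacobiBracket_one (h : IsContactAt α x) (hd : Odd d) (g : M → ℝ) :
    jacobiBracket α (fun _ => 1) g x = differential g x (reeb α x) := by
  have h0 : differential (d := d) (fun _ : M => (1 : ℝ)) x = 0 := mvfderiv_const _
  rw [jacobiBracket, h.contactHam_one hd, h0]
  simp

end IsContactAt

end Pointwise

section Pullback

variable {d e : ℕ} {M N : Type*} [TopologicalSpace M] [ChartedSpace (EuclideanSpace ℝ (Fin d)) M]
  [IsManifold (𝓡 d) ∞ M] [TopologicalSpace N] [ChartedSpace (EuclideanSpace ℝ (Fin e)) N]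
  [IsManifold (𝓡 e) ∞ N] {α : OneForm d M} {j : N → M} {x : N}

omit [IsManifold (𝓡 d) ∞ M] [IsManifold (𝓡 e) ∞ N] in
theorem differential_comp (hj : ContMDiff (𝓡 e) (𝓡 d) ∞ j) {f : M → ℝ} (hf : IsSmoothFun d f)
    (v : TangentSpace (𝓡 e) x) :
    differential (d := e) (f ∘ j) x v = differential f (j x) (mfderiv (𝓡 e) (𝓡 d) j x v) :=
  mvfderiv_comp_apply x (hf.contMDiffAt.mdifferentiableAt (by simp))
    (hj.contMDiffAt.mdifferentiableAt (by simp)) v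

/-- A preimage of `Z` under the differential of `j` satisfies the Reeb equations of the pullback by
naturality of `d`, and these have only one solution. -/
theorem mfderiv_reeb_pullback (hα : α.IsSmooth) (hj : ContMDiff (𝓡 e) (𝓡 d) ∞ j) (hd : Odd d)
    (he : Odd e) (h : IsContactAt α (j x)) (h' : IsContactAt (d := e) (α.pullback j) x)
    (hZ : reeb α (j x) ∈ (mfderiv (𝓡 e) (𝓡 d) j x).range) :
    mfderiv (𝓡 e) (𝓡 d) j x (reeb (α.pullback j) x) = reeb α (j x) := by
  obtain ⟨z, hz⟩ := hZ
  have hr := h.isReebVector_reeb hd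
  rw [← hz] at hr
  have hz' : IsReebVector (α.pullback j : OneForm e N) x z :=
    ⟨hr.1, fun w => (hα.extDeriv_pullback hj x z w).trans (hr.2 _)⟩
  rw [← h'.eq_reeb he hz']
  exact hz

/-- For tangent `W`, the Hamiltonian equations need testing only on tangent vectors: pulled back,
they are the equations that characterize the field of `f ∘ j`. -/
theorem mfderiv_contactHam_pullback (hα : α.IsSmooth) (hj : ContMDiff (𝓡 e) (𝓡 d) ∞ j)
    (hd : Odd d) (he : Odd e) (h : IsContactAt α (j x))
    (h' : IsContactAt (d := e) (α.pullback j) x)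
    (hZ : reeb α (j x) ∈ (mfderiv (𝓡 e) (𝓡 d) j x).range) {f : M → ℝ} (hf : IsSmoothFun d f)
    {W : TangentSpace (𝓡 d) (j x)} (hW : W ∈ (mfderiv (𝓡 e) (𝓡 d) j x).range)
    (hαW : α (j x) W = f (j x)) (hBW : ∀ w ∈ (mfderiv (𝓡 e) (𝓡 d) j x).range,
      -α.bilin (j x) W w =
        differential f (j x) w - differential f (j x) (reeb α (j x)) * α (j x) w) :
    mfderiv (𝓡 e) (𝓡 d) j x (contactHam (α.pullback j) (f ∘ j) x) = W := by
  obtain ⟨v, rfl⟩ := hW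
  refine congrArg (mfderiv (𝓡 e) (𝓡 d) j x)
    (h'.eq_contactHam (f := f ∘ j) (v := v) he hαW fun w => ?_).symm
  rw [differential_comp hj hf, differential_comp hj hf, mfderiv_reeb_pullback hα hj hd he h h' hZ]
  refine Eq.trans ?_ (hBW _ ⟨w, rfl⟩)
  exact congrArg Neg.neg (hα.extDeriv_pullback hj x v w)

end Pullback

end ContactDirac

/-! ### The constraints: regularity and the tangent space of the zero locus. -/

namespace ContactDirac

section Constraints

open Topology

variable {d k : ℕ} {M : Type*} [TopologicalSpace M] [ChartedSpace (EuclideanSpace ℝ (Fin d)) M]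
  {α : OneForm d M} {x : M}

theorem mvfderiv_comp_clm {F : Type*} [NormedAddCommGroup F] [NormedSpace ℝ F] {g : M → F}
    (hg : MDifferentiableAt (𝓡 d) 𝓘(ℝ, F) g x) (L : F →L[ℝ] ℝ) (v : TangentSpace (𝓡 d) x) :
    mvfderiv (𝓡 d) (L ∘ g) x v = L (mvfderiv (𝓡 d) g x v) := by
  have h := mfderiv_comp x (L.mdifferentiableAt (x := g x)) hg
  rw [ContinuousLinearMap.mfderiv_eq] at h
  exact congrArg (fun A => A v) h

section Pointwise

variable {ι : Type*} {G : ι → M → ℝ}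

theorem bilin_contactHam_constraint (h : IsContactAt α x) (hd : Odd d) {g : M → ℝ}
    (hZ : differential g x (reeb α x) = 0) (w : TangentSpace (𝓡 d) x) :
    α.bilin x (contactHam α g x) w = -differential g x w := by
  have := (h.contactHam_spec hd g).2 w
  rw [hZ, zero_mul, sub_zero] at this
  rw [← this, neg_neg]

/-- The zeroth order term of `[G_j, G_i]` carries the factor `G_i`, which vanishes on the zero
locus. -/
theorem bracketMatrix_eq (hx : x ∈ zeroLocus G) :
    bracketMatrix α G x =
      Matrix.of fun i j => differential (G i) x (contactHam α (G j) x) := by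
  ext i j
  simp [bracketMatrix, jacobiBracket, hx i]

variable [Fintype ι] [DecidableEq ι]

theorem exists_differential_eq (hx : x ∈ zeroLocus G) (hdet : (bracketMatrix α G x).det ≠ 0)
    (u : ι → ℝ) : ∃ v : TangentSpace (𝓡 d) x, ∀ i, differential (G i) x v = u i := by
  rw [bracketMatrix_eq hx] at hdet
  obtain ⟨c, hc⟩ := exists_apply_sum_eq (D := fun i => (differential (G i) x).toLinearMap) hdet u
  exact ⟨_, hc⟩

theorem finrank_iInf_ker_differential (hx : x ∈ zeroLocus G)
    (hdet : (bracketMatrix α G x).det ≠ 0) :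
    Fintype.card ι + Module.finrank ℝ
      (LinearMap.pi fun i => (differential (d := d) (G i) x).toLinearMap).ker = d := by
  have h1 := (LinearMap.pi fun i =>
    (differential (d := d) (G i) x).toLinearMap).finrank_range_add_finrank_ker
  rw [LinearMap.range_eq_top.mpr fun u => ?_, finrank_top, finrank_tangentSpace,
    Module.finrank_fintype_fun_eq_card] at h1
  · exact h1
  · obtain ⟨v, hv⟩ := exists_differential_eq hx hdet u
    exact ⟨v, funext hv⟩

theorem card_le_of_det_bracketMatrix_ne_zero (hx : x ∈ zeroLocus G)
    (hdet : (bracketMatrix α G x).det ≠ 0) : Fintype.card ι ≤ d :=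
  (Nat.le_add_right _ _).trans (finrank_iInf_ker_differential hx hdet).le

variable [IsManifold (𝓡 d) ∞ M]

/-- Each `G_i` is constant on the zero locus, which gives one inclusion; an immersion has injective
differential, so the dimensions agree. -/
theorem mem_range_mfderiv_incl_iff {e : ℕ} (hG : ∀ i, IsSmoothFun d (G i))
    [ChartedSpace (EuclideanSpace ℝ (Fin e)) (zeroLocus G)] [IsManifold (𝓡 e) ∞ (zeroLocus G)]
    (he : Fintype.card ι + e = d)
    (hj : Manifold.IsSmoothEmbedding (𝓡 e) (𝓡 d) ∞ (incl G)) (x : zeroLocus G)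
    (hdet : (bracketMatrix α G x).det ≠ 0) (v : TangentSpace (𝓡 d) (x : M)) :
    v ∈ (mfderiv (𝓡 e) (𝓡 d) (incl G) x).range ↔ ∀ i, differential (G i) (x : M) v = 0 := by
  have hle : (mfderiv (𝓡 e) (𝓡 d) (incl G) x).range ≤
      (LinearMap.pi fun i => (differential (d := d) (G i) (x : M)).toLinearMap).ker := by
    rintro _ ⟨v, rfl⟩
    rw [LinearMap.mem_ker]
    funext i
    have h0 : G i ∘ incl G = fun _ => 0 := funext fun y => y.2 i
    have h1 := differential_comp hj.contMDiff (hG i) v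
    rw [h0] at h1
    refine h1.symm.trans ?_
    rw [differential, mvfderiv_const, zero_apply]
    rfl
  have heq := Submodule.eq_of_le_of_finrank_eq hle (by
    have h1 := finrank_iInf_ker_differential x.2 hdet
    have h2 := LinearMap.finrank_range_of_inj (f := (mfderiv (𝓡 e) (𝓡 d) (incl G) x).toLinearMap)
      (mfderiv_injective_of_isImmersion hj.isImmersion x)
    rw [finrank_tangentSpace] at h2
    exact h2.trans (Nat.add_left_cancel (he.trans h1.symm)))
  rw [heq, LinearMap.mem_ker, funext_iff]
  rfl

end Pointwise

variable [IsManifold (𝓡 d) ∞ M] {G : Fin k → M → ℝ}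

theorem exists_isSmoothEmbedding_incl {e : ℕ} (hG : ∀ i, IsSmoothFun d (G i)) (he : k + e = d)
    (hdet : ∀ x ∈ zeroLocus G, (bracketMatrix α G x).det ≠ 0) :
    ∃ _ : ChartedSpace (EuclideanSpace ℝ (Fin e)) (zeroLocus G),
      IsManifold (𝓡 e) ∞ (zeroLocus G) ∧
      Manifold.IsSmoothEmbedding (𝓡 e) (𝓡 d) ∞ (incl G) := by
  let ε : (EuclideanSpace ℝ (Fin e) × EuclideanSpace ℝ (Fin k)) ≃L[ℝ] EuclideanSpace ℝ (Fin d) :=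
    ContinuousLinearEquiv.ofFinrankEq (by simp; omega)
  refine exists_isSmoothEmbedding_of_slice_charts (ε := ε) fun p hp => ?_
  let g : M → EuclideanSpace ℝ (Fin k) := fun x => WithLp.toLp 2 fun i => G i x
  have hg : ContMDiff (𝓡 d) 𝓘(ℝ, EuclideanSpace ℝ (Fin k)) ∞ g :=
    (EuclideanSpace.equiv (Fin k) ℝ).symm.contDiff.contMDiff.comp (contMDiff_pi_space.mpr hG)
  have hsurj : Function.Surjective (mvfderiv (𝓡 d) g p) := by
    intro u
    obtain ⟨v, hv⟩ := exists_differential_eq hp (hdet p hp) u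
    refine ⟨v, ?_⟩
    ext i
    have h1 : G i = (EuclideanSpace.proj i : EuclideanSpace ℝ (Fin k) →L[ℝ] ℝ) ∘ g := rfl
    have h2 := mvfderiv_comp_clm (hg.contMDiffAt.mdifferentiableAt (x := p) (by simp))
      (EuclideanSpace.proj i : EuclideanSpace ℝ (Fin k) →L[ℝ] ℝ) v
    rw [← hv i, h1]
    exact h2.symm
  obtain ⟨Φ, hΦ, hpΦ, hΦg⟩ := exists_slice_chart ε hg p hsurj
  refine ⟨Φ, hΦ, hpΦ, fun x hx => ?_⟩
  rw [hΦg x hx]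
  constructor
  · intro h
    ext i
    exact h i
  · intro h i
    exact congrArg (fun u : EuclideanSpace ℝ (Fin k) => u i) h

-- For an empty zero locus `k ≤ n` may fail, and then the truncated `2 * (n - k) + 1` is not the
-- expected codimension count; the structure is vacuous.
omit [IsManifold (𝓡 d) ∞ M] in
theorem exists_isSmoothEmbedding_of_isEmpty (e : ℕ) (S : Set M) [IsEmpty S] :
    ∃ _ : ChartedSpace (EuclideanSpace ℝ (Fin e)) S, IsManifold (𝓡 e) ∞ S ∧
      Manifold.IsSmoothEmbedding (𝓡 e) (𝓡 d) ∞ (Subtype.val : S → M) := by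
  let cs : ChartedSpace (EuclideanSpace ℝ (Fin e)) S := ChartedSpace.empty _ _
  refine ⟨cs, isManifold_of_contDiffOn _ _ _ fun _ _ h => h.elim, ?_, IsEmbedding.subtypeVal⟩
  exact Manifold.IsImmersionOfComplement.isImmersion (F := ℝ) fun p => isEmptyElim p

end Constraints

end ContactDirac

/-! ### Multipliers, the corrected Hamiltonian field, and the induced contact form. -/

namespace ContactDirac

section Main

variable {d e : ℕ} {ι M : Type*} [Fintype ι] [DecidableEq ι] [TopologicalSpace M]
  [ChartedSpace (EuclideanSpace ℝ (Fin d)) M]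
  {α : OneForm d M} {G : ι → M → ℝ}

omit [DecidableEq ι] in
theorem differential_correctedHam_eq (f : M → ℝ) (c : ι → ℝ) {x : M} (hx : x ∈ zeroLocus G)
    (j : ι) : differential (G j) x (correctedHam α G f c x) =
      differential (G j) x (contactHam α f x) - (bracketMatrix α G x).mulVec c j := by
  rw [bracketMatrix_eq hx]
  simp [correctedHam, Matrix.mulVec, dotProduct, mul_comm]

theorem existsUnique_isMultiplier (hdet : ∀ x ∈ zeroLocus G, (bracketMatrix α G x).det ≠ 0)
    (f : M → ℝ) : ∃! c : ι → zeroLocus G → ℝ, IsMultiplier α G f c := by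
  refine ⟨fun i x => ((bracketMatrix α G (x : M))⁻¹.mulVec
    fun j => differential (G j) (x : M) (contactHam α f x)) i, fun x j => ?_, fun c hc => ?_⟩
  · rw [differential_correctedHam_eq f _ x.2, Matrix.mulVec_mulVec,
      Matrix.mul_nonsing_inv _ (isUnit_iff_ne_zero.mpr (hdet x x.2)), Matrix.one_mulVec, sub_self]
  · funext i x
    have h : (fun j => differential (G j) (x : M) (contactHam α f x)) =
        (bracketMatrix α G (x : M)).mulVec fun i => c i x := funext fun j => by
      have := hc x j
      rw [differential_correctedHam_eq f _ x.2, sub_eq_zero] at this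
      exact this
    rw [h, Matrix.mulVec_mulVec,
      Matrix.nonsing_inv_mul _ (isUnit_iff_ne_zero.mpr (hdet x x.2)), Matrix.one_mulVec]

/-- The multipliers at a point, in terms of brackets. -/
theorem IsMultiplier.eq_neg_sum {f : M → ℝ} {c : ι → zeroLocus G → ℝ}
    (hc : IsMultiplier α G f c) (x : zeroLocus G) (h : IsContactAt α (x : M)) (hd : Odd d)
    (hdet : (bracketMatrix α G (x : M)).det ≠ 0) (i : ι) :
    c i x = -∑ j, (bracketMatrix α G (x : M))⁻¹ i j * jacobiBracket α (G j) f (x : M) := by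
  -- On the zero locus `Y_f(G_j) = [f, G_j] = -[G_j, f]`; hence the sign.
  have h1 : (bracketMatrix α G (x : M)).mulVec (fun i => c i x) =
      fun j => -jacobiBracket α (G j) f (x : M) := funext fun j => by
    have := hc x j
    rw [differential_correctedHam_eq f _ x.2, sub_eq_zero] at this
    rw [← this, ← h.jacobiBracket_antisymm hd, jacobiBracket, x.2 j, zero_mul, sub_zero]
  have h2 := congrFun (congrArg (bracketMatrix α G (x : M))⁻¹.mulVec h1) i
  rw [Matrix.mulVec_mulVec, Matrix.nonsing_inv_mul _ (isUnit_iff_ne_zero.mpr hdet),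
    Matrix.one_mulVec] at h2
  rw [h2]
  simp [Matrix.mulVec, dotProduct]

omit [DecidableEq ι] in
theorem contactForm_correctedHam (f : M → ℝ) (c : ι → ℝ) {x : M} (hx : x ∈ zeroLocus G)
    (h : IsContactAt α x) (hd : Odd d) : α x (correctedHam α G f c x) = f x := by
  simp [correctedHam, (h.contactHam_spec hd _).1, hx _]

-- The correction terms contribute `dα(Y_{G_j}, w) = -dG_j(w)`, which vanishes for `w` tangent to
-- the zero locus.
omit [DecidableEq ι] in
theorem bilin_correctedHam (f : M → ℝ) (c : ι → ℝ) {x : M}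
    (h : IsContactAt α x) (hd : Odd d) (hZ : ∀ j, differential (G j) x (reeb α x) = 0)
    {w : TangentSpace (𝓡 d) x} (hw : ∀ j, differential (G j) x w = 0) :
    -α.bilin x (correctedHam α G f c x) w =
      differential f x w - differential f x (reeb α x) * α x w := by
  have h1 : ∀ j, α.bilin x (contactHam α (G j) x) w = 0 := fun j => by
    rw [bilin_contactHam_constraint h hd (hZ j), hw, neg_zero]
  rw [← (h.contactHam_spec hd f).2 w]
  simp [correctedHam, h1]

variable [IsManifold (𝓡 d) ∞ M]
  [ChartedSpace (EuclideanSpace ℝ (Fin e)) (zeroLocus G)] [IsManifold (𝓡 e) ∞ (zeroLocus G)]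

theorem isContactAt_pullback_incl (hα : α.IsSmooth) (hd : Odd d)
    (hG : ∀ i, IsSmoothFun d (G i)) (he : Fintype.card ι + e = d)
    (hj : Manifold.IsSmoothEmbedding (𝓡 e) (𝓡 d) ∞ (incl G)) (x : zeroLocus G)
    (h : IsContactAt α (x : M)) (hZ : ∀ j, differential (G j) (x : M) (reeb α (x : M)) = 0)
    (hdet : (bracketMatrix α G (x : M)).det ≠ 0) :
    IsContactAt (d := e) (α.pullback (incl G)) x := by
  have hrange := mem_range_mfderiv_incl_iff hG he hj x hdet
  intro v hav hBv
  refine mfderiv_injective_of_isImmersion hj.isImmersion x ((Eq.trans ?_ (map_zero _).symm))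
  refine IsContactPair.eq_zero_of_forall_mem_ker h (α.bilin_isAlt (x : M))
    (D := fun i => (differential (G i) (x : M)).toLinearMap)
    (Y := fun i => contactHam α (G i) (x : M))
    (fun i => bilin_contactHam_constraint h hd (hZ i))
    (by rw [bracketMatrix_eq x.2] at hdet; exact hdet) ((hrange _).mp ⟨v, rfl⟩) hav fun w hw => ?_
  obtain ⟨u, rfl⟩ := (hrange w).mpr hw
  exact (hα.extDeriv_pullback hj.contMDiff x v u).symm.trans (hBv u)

end Main

end ContactDirac

/-! ### The theorem. -/

theorem theorem3p1 {n k : ℕ} {M : Type*} [TopologicalSpace M]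
    [ChartedSpace (EuclideanSpace ℝ (Fin (2 * n + 1))) M] [IsManifold (𝓡 (2 * n + 1)) ∞ M]
    (α : OneForm (2 * n + 1) M) (hα : IsContactForm α)
    (G : Fin (2 * k) → M → ℝ) (hG : ∀ j, IsSmoothFun (2 * n + 1) (G j))
    (hReeb : ∀ x ∈ zeroLocus G, ∀ j, jacobiBracket α (fun _ => 1) (G j) x = 0)
    (hdet : ∀ x ∈ zeroLocus G, (bracketMatrix α G x).det ≠ 0) :
    -- `N = {G = 0}` is an embedded submanifold of dimension `2 (n - k) + 1`
    ((zeroLocus G).Nonempty → k ≤ n) ∧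
    (∃ _ : ChartedSpace (EuclideanSpace ℝ (Fin (2 * (n - k) + 1))) (zeroLocus G),
      IsManifold (𝓡 (2 * (n - k) + 1)) ∞ (zeroLocus G) ∧
      Manifold.IsSmoothEmbedding (𝓡 (2 * (n - k) + 1)) (𝓡 (2 * n + 1)) ∞ (incl G)) ∧
    -- for the submanifold structure of `N`:
    ∀ (_ : ChartedSpace (EuclideanSpace ℝ (Fin (2 * (n - k) + 1))) (zeroLocus G))
      (_ : IsManifold (𝓡 (2 * (n - k) + 1)) ∞ (zeroLocus G)),
      Manifold.IsSmoothEmbedding (𝓡 (2 * (n - k) + 1)) (𝓡 (2 * n + 1)) ∞ (incl G) →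
      -- (a)
      IsContactSubmanifold (m := n - k) α (incl G) ∧
      (∀ x : zeroLocus G,
        mfderiv (𝓡 (2 * (n - k) + 1)) (𝓡 (2 * n + 1)) (incl G) x
          (reeb (α.pullback (incl G)) x) = reeb α (x : M)) ∧
      -- (b)
      ∀ f : M → ℝ, IsSmoothFun (2 * n + 1) f →
        (∃! c : Fin (2 * k) → zeroLocus G → ℝ, IsMultiplier α G f c) ∧
        (∀ c : Fin (2 * k) → zeroLocus G → ℝ, IsMultiplier α G f c → ∀ x : zeroLocus G,
          mfderiv (𝓡 (2 * (n - k) + 1)) (𝓡 (2 * n + 1)) (incl G) x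
            (contactHam (α.pullback (incl G)) (f ∘ incl G) x) =
              correctedHam α G f (fun i => c i x) (x : M)) ∧
        ∀ g : M → ℝ, IsSmoothFun (2 * n + 1) g →
          (∀ x : zeroLocus G,
            jacobiBracket (d := 2 * (n - k) + 1) (α.pullback (incl G))
                (f ∘ incl G) (g ∘ incl G) x =
              jacobiBracket α f g (x : M) +
                ∑ i, ∑ j, jacobiBracket α (G i) g (x : M) * (bracketMatrix α G (x : M))⁻¹ i j *
                  jacobiBracket α (G j) f (x : M)) ∧
          (((∀ x : zeroLocus G, contactHam α f (x : M) ∈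
                (mfderiv (𝓡 (2 * (n - k) + 1)) (𝓡 (2 * n + 1)) (incl G) x).range) ∨
              (∀ x : zeroLocus G, contactHam α g (x : M) ∈
                (mfderiv (𝓡 (2 * (n - k) + 1)) (𝓡 (2 * n + 1)) (incl G) x).range)) →
            ∀ x : zeroLocus G,
              jacobiBracket (d := 2 * (n - k) + 1) (α.pullback (incl G))
                  (f ∘ incl G) (g ∘ incl G) x =
                jacobiBracket α f g (x : M)) := by
  have hd : Odd (2 * n + 1) := odd_two_mul_add_one n
  have he : Odd (2 * (n - k) + 1) := odd_two_mul_add_one _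
  have hC : ∀ x, IsContactAt α x := fun x => (isContactAt_iff α x).mpr (hα.2 x)
  have hZ : ∀ x ∈ zeroLocus G, ∀ j, differential (G j) x (reeb α x) = 0 := fun x hx j => by
    rw [← (hC x).jacobiBracket_one hd]
    exact hReeb x hx j
  have hkn : (zeroLocus G).Nonempty → k ≤ n := by
    rintro ⟨x, hx⟩
    have := card_le_of_det_bracketMatrix_ne_zero hx (hdet x hx)
    rw [Fintype.card_fin] at this
    -- Here `2k ≤ 2n + 1`, and parity improves this to `k ≤ n`.
    omega
  refine ⟨hkn, ?_, ?_⟩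
  · rcases (zeroLocus G).eq_empty_or_nonempty with hemp | hne
    · have : IsEmpty (zeroLocus G) := Set.isEmpty_coe_sort.mpr hemp
      exact exists_isSmoothEmbedding_of_isEmpty _ _
    · have := hkn hne
      exact exists_isSmoothEmbedding_incl hG (by omega) hdet
  intro _ _ hj
  -- The count is stated for a given point since truncated subtraction makes it false when `k > n`.
  have hdim : ∀ _ : zeroLocus G, Fintype.card (Fin (2 * k)) + (2 * (n - k) + 1) = 2 * n + 1 :=
    fun x => by
      have := hkn ⟨x, x.2⟩
      rw [Fintype.card_fin]
      omega
  have hC' : ∀ x : zeroLocus G, IsContactAt (d := 2 * (n - k) + 1) (α.pullback (incl G)) x :=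
    fun x => isContactAt_pullback_incl hα.1 hd hG (hdim x) hj x (hC x) (hZ x x.2) (hdet x x.2)
  have hrange : ∀ (x : zeroLocus G) (v : TangentSpace (𝓡 (2 * n + 1)) (x : M)),
      v ∈ (mfderiv (𝓡 (2 * (n - k) + 1)) (𝓡 (2 * n + 1)) (incl G) x).range ↔
        ∀ i, differential (G i) (x : M) v = 0 :=
    fun x => mem_range_mfderiv_incl_iff hG (hdim x) hj x (hdet x x.2)
  have hZmem : ∀ x : zeroLocus G, reeb α (x : M) ∈
      (mfderiv (𝓡 (2 * (n - k) + 1)) (𝓡 (2 * n + 1)) (incl G) x).range :=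
    fun x => (hrange x _).mpr (hZ x x.2)
  have hreeb : ∀ x : zeroLocus G,
      mfderiv (𝓡 (2 * (n - k) + 1)) (𝓡 (2 * n + 1)) (incl G) x
        (reeb (α.pullback (incl G)) x) = reeb α (x : M) :=
    fun x => mfderiv_reeb_pullback hα.1 hj.contMDiff hd he (hC x) (hC' x) (hZmem x)
  refine ⟨⟨hj, fun x => ?_, fun x v hv hvw => ?_, hα.1.pullback hj.contMDiff,
    fun x => (isContactAt_iff _ x).mp (hC' x)⟩, hreeb, fun f hf => ?_⟩
  · rw [eq_top_iff]
    intro v _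
    have hr := (hC x).isReebVector_reeb hd
    -- Transversality holds because `v = α(v) Z + (v - α(v) Z)`, with `Z` tangent and the rest in
    -- `ker α`.
    have hker : v - α (x : M) v • reeb α (x : M) ∈ (α (x : M)).ker := by
      rw [LinearMap.mem_ker]
      simp [hr.1]
    have := Submodule.add_mem_sup (Submodule.smul_mem _ (α (x : M) v) (hZmem x)) hker
    rwa [add_sub_cancel] at this
  · refine hC' x v hv fun w => ?_
    have hr := (hC' x).isReebVector_reeb he
    have h0 : OneForm.bilin (d := 2 * (n - k) + 1) (α.pullback (incl G)) x v
        (reeb (α.pullback (incl G)) x) = 0 := by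
      rw [← (OneForm.bilin_isAlt _ x).neg_eq]
      exact neg_eq_zero.mpr (hr.2 v)
    -- The hypothesis tests only vectors in the kernel of the induced form; a general `w` is
    -- projected there along the Reeb vector, which pairs to zero with `v`.
    have h1 := hvw (w - (α.pullback (incl G) : OneForm (2 * (n - k) + 1) _) x w •
      reeb (α.pullback (incl G)) x) (by simp [hr.1])
    rw [← OneForm.bilin_apply, map_sub, map_smul, h0, smul_zero, sub_zero] at h1
    exact h1
  have hex := existsUnique_isMultiplier hdet f
  have hham : ∀ c : Fin (2 * k) → zeroLocus G → ℝ, IsMultiplier α G f c → ∀ x : zeroLocus G,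
      mfderiv (𝓡 (2 * (n - k) + 1)) (𝓡 (2 * n + 1)) (incl G) x
        (contactHam (α.pullback (incl G)) (f ∘ incl G) x) =
          correctedHam α G f (fun i => c i x) (x : M) := fun c hc x =>
    mfderiv_contactHam_pullback hα.1 hj.contMDiff hd he (hC x) (hC' x) (hZmem x) hf
      ((hrange x _).mpr (hc x)) (contactForm_correctedHam f _ x.2 (hC x) hd)
      fun w hw => bilin_correctedHam f _ (hC x) hd (hZ x x.2) ((hrange x w).mp hw)
  refine ⟨hex, hham, fun g hg => ?_⟩
  have hbracket : ∀ x : zeroLocus G,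
      jacobiBracket (d := 2 * (n - k) + 1) (α.pullback (incl G)) (f ∘ incl G) (g ∘ incl G) x =
        jacobiBracket α f g (x : M) +
          ∑ i, ∑ j, jacobiBracket α (G i) g (x : M) * (bracketMatrix α G (x : M))⁻¹ i j *
            jacobiBracket α (G j) f (x : M) := by
    intro x
    obtain ⟨c, hc, -⟩ := hex
    have hGg : ∀ i, differential g (x : M) (contactHam α (G i) (x : M)) =
        jacobiBracket α (G i) g (x : M) := fun i => by
      rw [jacobiBracket, hZ x x.2, mul_zero, sub_zero]
    have hsum : ∑ i, ∑ j, jacobiBracket α (G i) g (x : M) * (bracketMatrix α G (x : M))⁻¹ i j *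
        jacobiBracket α (G j) f (x : M) = -∑ i, c i x * jacobiBracket α (G i) g (x : M) := by
      rw [← Finset.sum_neg_distrib]
      refine Finset.sum_congr rfl fun i _ => ?_
      rw [hc.eq_neg_sum x (hC x) hd (hdet x x.2), neg_mul, neg_neg, Finset.sum_mul]
      exact Finset.sum_congr rfl fun j _ => by ring
    -- The bracket on the zero locus becomes `dg(W_f) - g Z(f)`, and `dg(W_f)` is `Y_f(g)` minus the
    -- multipliers times `Y_{G_i}(g) = [G_i, g]`.
    rw [hsum, jacobiBracket, differential_comp hj.contMDiff hg, differential_comp hj.contMDiff hf,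
      hham c hc x, hreeb x, jacobiBracket]
    simp only [correctedHam, map_sub, map_sum, map_smul, hGg, smul_eq_mul, Function.comp_apply]
    ring
  refine ⟨hbracket, fun htan x => ?_⟩
  rw [hbracket x, add_eq_left]
  refine Finset.sum_eq_zero fun i _ => Finset.sum_eq_zero fun j _ => ?_
  -- Tangency of `Y_q` means `Y_q(G_l) = 0`, and by antisymmetry this is `[G_l, q] = 0`; every term
  -- of the correction has one such factor.
  have hvanish : ∀ (q : M → ℝ) (l : Fin (2 * k)), contactHam α q (x : M) ∈
      (mfderiv (𝓡 (2 * (n - k) + 1)) (𝓡 (2 * n + 1)) (incl G) x).range →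
      jacobiBracket α (G l) q (x : M) = 0 := fun q l hq => by
    rw [(hC x).jacobiBracket_antisymm hd, jacobiBracket, (hrange x _).mp hq l, x.2 l, zero_mul,
      sub_zero, neg_zero]
  rcases htan with hf' | hg'
  · rw [hvanish f j (hf' x), mul_zero]
  · rw [hvanish g i (hg' x), zero_mul, zero_mul]
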